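/- Let $0<\alpha\le 1$ and $0<p\le 1$. On a probability space let $(Q_n)_{n\ge 0}$ be a Markov chain on $\{0,1,2,\dots\}$ with $Q_0=0$ almost surely and transition probabilities $$q_{k,k+1}=p\ \ (k\ge 0),\qquad q_{k,k-1}=1-p\ \ (k\ge 1),\qquad q_{0,0}=1-p,$$ all others being zero. Let $T_1,T_2,\dots$ be i.i.d. random variables, independent of $(Q_n)$, with the Mittag-Leffler distribution of index $\alpha$, i.e. $$\mathbb P\{T_i\le x\}=1-E_{\alpha,1}(-x^\alpha)\quad (x\ge 0),\qquad E_{\alpha,\beta}(x)=\sum_{\ell\ge 0}\frac{x^\ell}{\Gamma(\beta+\alpha\ell)}.$$ Let $N^{(\alpha)}(t)=\max\{k: T_1+\dots+T_k\le t<T_1+\dots+T_{k+1}\}$, let $L(t)=Q_{N^{(\alpha)}(t)}$ be the queue length, $p_{0,0}(t)=\mathbb P\{L(t)=0\}$, and $M(z,t)=\mathbb E\,e^{zL(t)}$ for $z\in\mathbb R$. Then for every $z\in\mathbb R$ the following hold. 1. $M(z,t)<\infty$ for all $t\ge 0$. 2. For every $t>0$ the Caputo derivative of order $\alpha$ of $M(z,\cdot)$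 at $t$ exists and $$\frac{d^\alpha}{dt^\alpha}M(z,t)=(1-p)(1-e^{-z})\,p_{0,0}(t)+\big(pe^z-1+(1-p)e^{-z}\big)M(z,t).$$ Here, for $\alpha<1$, $\frac{d^\alpha}{dt^\alpha}f(t)=\frac1{\Gamma(1-\alpha)}\int_0^t(t-u)^{-\alpha}f'(u)\,du$, where existence means that $f$ is continuous on $[0,t]$ and differentiable on $(0,t)$ and that the integral converges absolutely; for $\alpha=1$ it is the ordinary derivative (again with $f$ continuous on $[0,t]$). 3. For $s>0$ put $$r_{1}(s)=\frac{1+s^\alpha+\sqrt{(1+s^\alpha)^2-4p(1-p)}}{2p},\qquad r_{2}(s)=\frac{1+s^\alpha-\sqrt{(1+s^\alpha)^2-4p(1-p)}}{2p}.$$ The Laplace integral $\int_0^\infty e^{-st}M(z,t)\,dt$ converges if and only if $e^z<r_1(s)$, and in that case $$\int_0^\infty e^{-st}M(z,t)\,dt=\frac{-s^{\alpha-1}}{p\,(e^z-r_1(s))\,(1-r_2(s))}.$$ -/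

import Mathlib

open MeasureTheory ProbabilityTheory

noncomputable section

namespace FractionalQueue

/-- The two-parameter Mittag-Leffler function `E_{α,β}(x) = ∑ xˡ / Γ(β + α l)`. -/
def mittagLeffler (α β x : ℝ) : ℝ :=
  ∑' l : ℕ, x ^ l / Real.Gamma (β + α * l)

/-- `X` has the Mittag-Leffler distribution of index `α` (and scale `1`): its cumulative
distribution function on `[0, ∞)` is `1 - E_{α,1}(-x^α)`.  In particular `X > 0` a.s. -/
def IsMittagLefflerDistributed {Ω : Type*} [MeasurableSpace Ω] (α : ℝ) (X : Ω → ℝ)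
    (μ : Measure Ω) : Prop :=
  ∀ x : ℝ, 0 ≤ x → μ.real {ω | X ω ≤ x} = 1 - mittagLeffler α 1 (-(x ^ α))

/-- Transition probabilities of the discrete-time queue: an arrival (`i → i + 1`) with probability
`p`, a service completion (`i → i - 1`) with probability `1 - p`.  The subtraction is truncated:
a service completion in an empty queue leaves it empty. -/
def queueTransition (p : ℝ) (i j : ℕ) : ℝ :=
  if j = i + 1 then p else if j = i - 1 then 1 - p else 0

/-- `Q` is a Markov chain on `ℕ`, started at `0`, with transition probabilities
`queueTransition p`.  The Markov property
`P(Q_{n+1} = x_{n+1} | Q_0 = x_0, …, Q_n = x_n) = q(x_n, x_{n+1})` is written without division. -/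
structure IsDiscreteQueue {Ω : Type*} [MeasurableSpace Ω] (p : ℝ) (Q : ℕ → Ω → ℕ)
    (μ : Measure Ω) : Prop where
  measurable : ∀ n, Measurable (Q n)
  initial : ∀ᵐ ω ∂μ, Q 0 ω = 0
  markov : ∀ (n : ℕ) (x : ℕ → ℕ),
    μ.real {ω | ∀ k ≤ n + 1, Q k ω = x k} =
      μ.real {ω | ∀ k ≤ n, Q k ω = x k} * queueTransition p (x n) (x (n + 1))

/-- `T 0, T 1, …` are i.i.d. inter-event times with the Mittag-Leffler distribution. -/
structure IsMittagLefflerRenewal {Ω : Type*} [MeasurableSpace Ω] (α : ℝ) (T : ℕ → Ω → ℝ)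
    (μ : Measure Ω) : Prop where
  measurable : ∀ n, Measurable (T n)
  indep : iIndepFun T μ
  law : ∀ n, IsMittagLefflerDistributed α (T n) μ

/-- The counting process of the inter-event times `T`:
`N(t) = max {k : T_0 + ⋯ + T_{k-1} ≤ t < T_0 + ⋯ + T_k}`. -/
def countingProcess {Ω : Type*} (T : ℕ → Ω → ℝ) (t : ℝ) (ω : Ω) : ℕ :=
  sSup {k : ℕ | ∑ i ∈ Finset.range k, T i ω ≤ t ∧ t < ∑ i ∈ Finset.range (k + 1), T i ω}

/-- The queue length `L(t) = Q_{N(t)}`. -/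
def queueLength {Ω : Type*} (Q : ℕ → Ω → ℕ) (T : ℕ → Ω → ℝ) (t : ℝ) (ω : Ω) : ℕ :=
  Q (countingProcess T t ω) ω

/-- The moment generating function `M(z, t) = E exp(z L(t))`. -/
def queueMgf {Ω : Type*} [MeasurableSpace Ω] (μ : Measure Ω) (Q : ℕ → Ω → ℕ) (T : ℕ → Ω → ℝ)
    (z t : ℝ) : ℝ :=
  mgf (fun ω => (queueLength Q T t ω : ℝ)) μ z

/-- The probability `p_{0,0}(t)` of an empty queue at time `t`. -/
def emptyProb {Ω : Type*} [MeasurableSpace Ω] (μ : Measure Ω) (Q : ℕ → Ω → ℕ) (T : ℕ → Ω → ℝ)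
    (t : ℝ) : ℝ :=
  μ.real {ω | queueLength Q T t ω = 0}

/-- The Caputo derivative of order `α ∈ (0, 1]` of `f` at `t > 0` exists and equals `c`:
`c = (1 / Γ(1 - α)) ∫₀ᵗ (t - u)^{-α} f'(u) du` if `α < 1`, where `f` is continuous on `[0, t]`,
differentiable on `(0, t)`, and the integral converges absolutely; the derivative of order `1` is
the ordinary derivative. -/
def HasCaputoDerivAt (α : ℝ) (f : ℝ → ℝ) (c t : ℝ) : Prop :=
  if α = 1 then ContinuousOn f (Set.Icc 0 t) ∧ HasDerivAt f c t
  else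
    ContinuousOn f (Set.Icc 0 t) ∧
    (∀ u ∈ Set.Ioo 0 t, DifferentiableAt ℝ f u) ∧
    IntegrableOn (fun u => (t - u) ^ (-α) * deriv f u) (Set.Ioo 0 t) ∧
    1 / Real.Gamma (1 - α) * ∫ u in Set.Ioo 0 t, (t - u) ^ (-α) * deriv f u = c

/-- The Laplace transform `∫₀^∞ exp(-s t) f(t) dt`. -/
def laplaceTransform (f : ℝ → ℝ) (s : ℝ) : ℝ :=
  ∫ t in Set.Ioi (0 : ℝ), Real.exp (-s * t) * f t

/-- The Laplace integral of `f` at `s` converges absolutely. -/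
def LaplaceConvergent (f : ℝ → ℝ) (s : ℝ) : Prop :=
  IntegrableOn (fun t => Real.exp (-s * t) * f t) (Set.Ioi (0 : ℝ))

/-- The larger root `r₁(s)`. -/
def r₁ (α p s : ℝ) : ℝ :=
  (1 + s ^ α + Real.sqrt ((1 + s ^ α) ^ 2 - 4 * p * (1 - p))) / (2 * p)

/-- The smaller root `r₂(s)`. -/
def r₂ (α p s : ℝ) : ℝ :=
  (1 + s ^ α - Real.sqrt ((1 + s ^ α) ^ 2 - 4 * p * (1 - p))) / (2 * p)

end FractionalQueue

end

noncomputable section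

namespace FractionalQueue

open Set Filter Topology

/-! Write y = e^z and b_n = E y^{Q_n}. Conditioning on the number of renewals gives M(z,t) = ∑
P(N(t) = n) b_n (`lintegral_queueLength`), and everything is expanded in the monomials
t^{αm}/Γ(αm+1), which behave like powers x^m of a formal variable x: convolution of laws becomes
multiplication of power series, and the Caputo derivative lowers m by one.

In this calculus P(T_1 ≤ t) is x/(1+x), so the n-th partial sum has distribution function
(x/(1+x))^n (`cdf_partialSum`) and P(N(t) = n) is x^n/(1+x)^{n+1}, with coefficients (-1)^{m+n}
C(m,n). By Newton's formula, averaging a sequence b against these weights gives the series whose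
m-th coefficient is the iterated difference Δ^m b(0) (`hasSum_countCoeff`). Hence the Caputo
derivative replaces b by Δb (`hasCaputoDerivAt`). The one-step recursion of the chain
(`integral_pow_succ`) expresses Δb_n linearly through b_n and P(Q_n = 0), and averaging again gives
the fractional equation. The bound b_n ≤ max(y, 1/y)^n against the superexponential growth of Γ
makes all series converge absolutely.

For the Laplace integral, T_i has transform 1/(1+s^α), found termwise for s > 1 and continued
analytically (`mgf_eq`). So P(N(t) = n) has transform s^{α-1} x^{n+1}, now with x = 1/(1+s^α), and
up to a factor the Laplace integral of M is ∑_n x^n E y^{Q_n} = ∑_k G_k y^k, where G_k = ∑_n x^n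
P(Q_n = k). The sequence G is bounded and solves a second-order recursion governed by r₁ and r₂;
since r₂ < 1 < r₁, boundedness forces G_k = G_0 r₁^{-k} (`occupation_eq`), and the equation at state
0 fixes G_0. What remains is a geometric series of ratio e^z/r₁. It is summed in [0,∞], so one
identity (`lintegral_exp_mul_queueMgf`) yields both the convergence criterion and the value. -/

/-! ### Growth of Γ and fractional power series. -/

/-- `Γ(x + 1) ≥ A ^ x e^{-A}`. -/
lemma rpow_mul_exp_neg_le_Gamma {x A : ℝ} (hx : 0 ≤ x) (hA : 0 ≤ A) :
    A ^ x * Real.exp (-A) ≤ Real.Gamma (x + 1) := by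
  have hint := Real.GammaIntegral_convergent (show 0 < x + 1 by linarith)
  rw [Real.Gamma_eq_integral (by linarith)]
  calc A ^ x * Real.exp (-A) = ∫ t in Ioi A, A ^ x * Real.exp (-t) := by
        rw [integral_const_mul, integral_exp_neg_Ioi]
    _ ≤ ∫ t in Ioi A, Real.exp (-t) * t ^ (x + 1 - 1) := by
        refine setIntegral_mono_on ?_ (hint.mono_set (Ioi_subset_Ioi hA)) measurableSet_Ioi ?_
        · exact (integrableOn_exp_neg_Ioi A).const_mul _
        · intro t ht
          rw [add_sub_cancel_right, mul_comm]
          have : A ^ x ≤ t ^ x := Real.rpow_le_rpow hA (le_of_lt ht) hx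
          gcongr
    _ ≤ ∫ t in Ioi 0, Real.exp (-t) * t ^ (x + 1 - 1) := by
        refine setIntegral_mono_set hint ?_ (Ioi_subset_Ioi hA).eventuallyLE
        filter_upwards [ae_restrict_mem measurableSet_Ioi] with t ht
        have : (0 : ℝ) < t := ht
        positivity

/-- The fractional monomial `t ^ (α m) / Γ(α m + 1)`. -/
def fracMonomial (α : ℝ) (m : ℕ) (t : ℝ) : ℝ :=
  t ^ (α * m) / Real.Gamma (α * m + 1)

lemma fracMonomial_nonneg {α t : ℝ} (hα : 0 < α) (ht : 0 ≤ t) (m : ℕ) :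
    0 ≤ fracMonomial α m t := by
  have : 0 < Real.Gamma (α * m + 1) := Real.Gamma_pos_of_pos (by positivity)
  unfold fracMonomial
  positivity

lemma fracMonomial_zero (α t : ℝ) : fracMonomial α 0 t = 1 := by
  simp [fracMonomial]

lemma fracMonomial_eq_pow {α t : ℝ} (ht : 0 ≤ t) (m : ℕ) :
    fracMonomial α m t = (t ^ α) ^ m / Real.Gamma (α * m + 1) := by
  rw [fracMonomial, Real.rpow_mul ht, Real.rpow_natCast]

/-- In the lower bound for Γ the parameter A is free. Taking A^α = 2|C| + 1 bounds the terms by a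
geometric series of ratio |C|/(2|C|+1) < 1. -/
lemma summable_pow_div_Gamma {α : ℝ} (hα : 0 < α) (C : ℝ) :
    Summable fun m : ℕ => C ^ m / Real.Gamma (α * m + 1) := by
  set D : ℝ := 2 * |C| + 1
  have hD : 0 < D := by positivity
  set A : ℝ := D ^ (1 / α)
  have hA : 0 < A := by positivity
  have hAα : A ^ α = D := by
    rw [← Real.rpow_mul hD.le, one_div_mul_cancel hα.ne', Real.rpow_one]
  refine Summable.of_norm_bounded (g := fun m : ℕ => Real.exp A * (|C| / D) ^ m) ?_ ?_
  · refine (summable_geometric_of_lt_one (by positivity) ?_).mul_left _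
    rw [div_lt_one hD]
    have := abs_nonneg C
    simp only [D]
    linarith
  · intro m
    have hG := rpow_mul_exp_neg_le_Gamma (x := α * m) (by positivity) hA.le
    rw [Real.rpow_mul hA.le, hAα, Real.rpow_natCast] at hG
    have hG0 : 0 < Real.Gamma (α * m + 1) := Real.Gamma_pos_of_pos (by positivity)
    rw [norm_div, norm_pow, Real.norm_eq_abs, Real.norm_of_nonneg hG0.le, div_le_iff₀ hG0, div_pow]
    calc |C| ^ m = Real.exp A * (|C| ^ m / D ^ m) * (D ^ m * Real.exp (-A)) := by
          rw [Real.exp_neg]; field_simp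
      _ ≤ _ := by gcongr

lemma summable_pow_mul_fracMonomial {α : ℝ} (hα : 0 < α) (C : ℝ) {t : ℝ} (ht : 0 ≤ t) :
    Summable fun m : ℕ => C ^ m * fracMonomial α m t := by
  refine (summable_pow_div_Gamma hα (C * t ^ α)).congr fun m => ?_
  rw [fracMonomial_eq_pow ht, mul_pow, mul_div_assoc]

/-- The series `∑ a_m t ^ (α m) / Γ(α m + 1)`. -/
def fracSeries (α : ℝ) (a : ℕ → ℝ) (t : ℝ) : ℝ :=
  ∑' m, a m * fracMonomial α m t

/-- The sequence `a` grows at most exponentially. -/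
def ExpBounded (a : ℕ → ℝ) : Prop :=
  ∃ K C : ℝ, 0 ≤ K ∧ 0 ≤ C ∧ ∀ m, |a m| ≤ K * C ^ m

lemma ExpBounded.summable_abs {α : ℝ} {a : ℕ → ℝ} (ha : ExpBounded a) (hα : 0 < α) {t : ℝ}
    (ht : 0 ≤ t) : Summable fun m => |a m| * fracMonomial α m t := by
  obtain ⟨K, C, hK, hC, h⟩ := ha
  refine Summable.of_nonneg_of_le (fun m => mul_nonneg (abs_nonneg _) (fracMonomial_nonneg hα ht m))
    (fun m => ?_) ((summable_pow_mul_fracMonomial hα C ht).mul_left K)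
  rw [← mul_assoc]
  exact mul_le_mul_of_nonneg_right (h m) (fracMonomial_nonneg hα ht m)

lemma ExpBounded.summable {α : ℝ} {a : ℕ → ℝ} (ha : ExpBounded a) (hα : 0 < α) {t : ℝ}
    (ht : 0 ≤ t) : Summable fun m => a m * fracMonomial α m t := by
  refine Summable.of_abs ((ha.summable_abs hα ht).congr fun m => ?_)
  rw [abs_mul, abs_of_nonneg (fracMonomial_nonneg hα ht m)]

lemma ExpBounded.shift {a : ℕ → ℝ} (ha : ExpBounded a) : ExpBounded fun m => a (m + 1) := by
  obtain ⟨K, C, hK, hC, h⟩ := ha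
  exact ⟨K * C, C, by positivity, hC, fun m => (h (m + 1)).trans_eq (by ring)⟩

lemma ExpBounded.cast_mul {a : ℕ → ℝ} (ha : ExpBounded a) : ExpBounded fun m => (m : ℝ) * a m := by
  obtain ⟨K, C, hK, hC, h⟩ := ha
  refine ⟨K, 2 * C, hK, by positivity, fun m => ?_⟩
  rw [abs_mul, Nat.abs_cast, mul_pow]
  have h2 : (m : ℝ) ≤ 2 ^ m := by exact_mod_cast Nat.lt_two_pow_self.le
  calc (m : ℝ) * |a m| ≤ 2 ^ m * (K * C ^ m) := by gcongr; exact h m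
    _ = _ := by ring

lemma mittagLeffler_eq_fracSeries {α x : ℝ} (hx : 0 ≤ x) :
    mittagLeffler α 1 (-(x ^ α)) = fracSeries α (fun m => (-1) ^ m) x := by
  refine tsum_congr fun m => ?_
  rw [fracMonomial_eq_pow hx, neg_pow, mul_div_assoc, add_comm 1]

/-! ### Termwise calculus and the Caputo derivative. -/

/-- Euler's beta integral over `(0, t)`. -/
lemma integral_rpow_mul_rpow {a b t : ℝ} (ha : 0 < a) (hb : 0 < b) (ht : 0 < t) :
    ∫ u in Ioo 0 t, (t - u) ^ (a - 1) * u ^ (b - 1) =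
      Real.Gamma a * Real.Gamma b * (t ^ (a + b - 1) / Real.Gamma (a + b)) := by
  have h := Complex.betaIntegral_scaled (b : ℂ) (a : ℂ) ht
  rw [Complex.betaIntegral_eq_Gamma_mul_div _ _ (by simpa) (by simpa),
    intervalIntegral.integral_of_le ht.le, integral_Ioc_eq_integral_Ioo] at h
  have h2 : ∫ u in Ioo 0 t, ((u : ℂ) ^ ((b : ℂ) - 1) * ((t : ℂ) - u) ^ ((a : ℂ) - 1)) =
      ∫ u in Ioo 0 t, (((t - u) ^ (a - 1) * u ^ (b - 1) : ℝ) : ℂ) := by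
    refine setIntegral_congr_fun measurableSet_Ioo fun u hu => ?_
    have h1 : 0 ≤ t - u := by linarith [hu.2]
    rw [Complex.ofReal_mul, Complex.ofReal_cpow h1, Complex.ofReal_cpow hu.1.le]
    push_cast
    ring
  rw [h2, integral_complex_ofReal] at h
  have h3 : ((t : ℂ) ^ ((b : ℂ) + a - 1)) = ((t ^ (a + b - 1) : ℝ) : ℂ) := by
    rw [Complex.ofReal_cpow ht.le]; push_cast; ring_nf
  rw [h3, ← Complex.ofReal_add, Complex.Gamma_ofReal, Complex.Gamma_ofReal,
    Complex.Gamma_ofReal] at h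
  have h4 := congrArg Complex.re h
  norm_cast at h4
  rw [h4, add_comm b a]
  ring

/-- A non-integrable function has Bochner integral 0 by convention, so the positive value of the
beta integral already implies integrability. -/
lemma integrableOn_rpow_mul_rpow {a b t : ℝ} (ha : 0 < a) (hb : 0 < b) (ht : 0 < t) :
    IntegrableOn (fun u => (t - u) ^ (a - 1) * u ^ (b - 1)) (Ioo 0 t) := by
  refine Integrable.of_integral_ne_zero ?_
  rw [integral_rpow_mul_rpow ha hb ht]
  have h1 := Real.Gamma_pos_of_pos ha
  have h2 := Real.Gamma_pos_of_pos hb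
  have h3 := Real.Gamma_pos_of_pos (add_pos ha hb)
  positivity

/-- The integral of an absolutely summable series of functions. -/
lemma integrable_tsum_of_summable_integral_norm {X : Type*} [MeasurableSpace X] {ν : Measure X}
    {f : ℕ → X → ℝ} (hf : ∀ m, Integrable (f m) ν) (hs : Summable fun m => ∫ x, ‖f m x‖ ∂ν) :
    Integrable (fun x => ∑' m, f m x) ν := by
  have hlt : ∑' m, ∫⁻ x, ‖f m x‖ₑ ∂ν < ⊤ := by
    have : ∀ m, ∫⁻ x, ‖f m x‖ₑ ∂ν = ENNReal.ofReal (∫ x, ‖f m x‖ ∂ν) := fun m => by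
      rw [ofReal_integral_norm_eq_lintegral_enorm (hf m)]
    simp_rw [this]
    rw [← ENNReal.ofReal_tsum_of_nonneg (fun m => integral_nonneg fun _ => norm_nonneg _) hs]
    exact ENNReal.ofReal_lt_top
  have hae : ∀ᵐ x ∂ν, Summable fun m => f m x := by
    rw [← lintegral_tsum (fun m => (hf m).1.enorm)] at hlt
    filter_upwards [ae_lt_top' (AEMeasurable.tsum fun m => (hf m).1.enorm) hlt.ne] with x hx
    exact (tsum_enorm_ne_top_iff_summable_norm.1 hx.ne).of_norm
  refine ⟨?_, ?_⟩
  · refine aestronglyMeasurable_of_tendsto_ae atTop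
      (f := fun n x => ∑ m ∈ Finset.range n, f m x) (fun n => ?_) ?_
    · exact Finset.aestronglyMeasurable_fun_sum _ fun m _ => (hf m).1
    · filter_upwards [hae] with x hx using hx.hasSum.tendsto_sum_nat
  · refine lt_of_le_of_lt ?_ hlt
    rw [← lintegral_tsum (fun m => (hf m).1.enorm)]
    exact lintegral_mono fun x => enorm_tsum_le_tsum_enorm

lemma continuous_fracMonomial {α : ℝ} (hα : 0 ≤ α) (m : ℕ) : Continuous (fracMonomial α m) := by
  unfold fracMonomial
  exact (Real.continuous_rpow_const (by positivity)).div_const _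

lemma fracMonomial_mono {α : ℝ} (hα : 0 < α) (m : ℕ) {s t : ℝ} (hs : 0 ≤ s) (hst : s ≤ t) :
    fracMonomial α m s ≤ fracMonomial α m t := by
  have : 0 < Real.Gamma (α * m + 1) := Real.Gamma_pos_of_pos (by positivity)
  unfold fracMonomial
  gcongr

lemma ExpBounded.continuousOn_fracSeries {α : ℝ} {a : ℕ → ℝ} (ha : ExpBounded a) (hα : 0 < α)
    (t : ℝ) : ContinuousOn (fracSeries α a) (Icc 0 t) := by
  rcases lt_or_ge t 0 with ht | ht
  · simp [Icc_eq_empty_of_lt ht]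
  refine continuousOn_tsum
    (fun m => ((continuous_fracMonomial hα.le m).const_mul (a m)).continuousOn)
    (ha.summable_abs hα ht) fun m x hx => ?_
  rw [norm_mul, Real.norm_eq_abs, Real.norm_of_nonneg (fracMonomial_nonneg hα hx.1 m)]
  exact mul_le_mul_of_nonneg_left (fracMonomial_mono hα m hx.1 hx.2) (abs_nonneg _)

lemma hasDerivAt_fracMonomial (α : ℝ) (m : ℕ) {t : ℝ} (ht : 0 < t) :
    HasDerivAt (fracMonomial α m) (α * m * fracMonomial α m t / t) t := by
  have h := (Real.hasDerivAt_rpow_const (x := t) (p := α * m) (Or.inl ht.ne')).div_const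
    (Real.Gamma (α * m + 1))
  refine h.congr_deriv ?_
  rw [fracMonomial, Real.rpow_sub_one ht.ne']
  ring

/-- The functional equation of Γ absorbs the factor α(m+1) and leaves the form u^{b-1}/Γ(b) that
fits the beta integral. -/
lemma fracMonomial_succ_deriv {α : ℝ} (hα : 0 < α) (m : ℕ) {t : ℝ} (ht : 0 < t) :
    α * (m + 1 : ℕ) * fracMonomial α (m + 1) t / t =
      t ^ (α * (m + 1 : ℕ) - 1) / Real.Gamma (α * (m + 1 : ℕ)) := by
  have h0 : 0 < α * ((m + 1 : ℕ) : ℝ) := by positivity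
  rw [fracMonomial, Real.Gamma_add_one h0.ne', Real.rpow_sub_one ht.ne']
  have := Real.Gamma_pos_of_pos h0
  field_simp

/-- Termwise differentiation is dominated on (t/2, 2t): the factor m produced by the derivative
keeps the coefficients exponentially bounded, and 1/y stays below 2/t. The constant term drops out.
-/
lemma ExpBounded.hasDerivAt_fracSeries {α : ℝ} {a : ℕ → ℝ} (ha : ExpBounded a) (hα : 0 < α)
    {t : ℝ} (ht : 0 < t) :
    HasDerivAt (fracSeries α a)
      (∑' m, a (m + 1) * (t ^ (α * (m + 1 : ℕ) - 1) / Real.Gamma (α * (m + 1 : ℕ)))) t := by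
  set u : ℕ → ℝ := fun m => α / (t / 2) * (|(m : ℝ) * a m| * fracMonomial α m (2 * t))
  have hu : Summable u := (ha.cast_mul.summable_abs hα (by positivity)).mul_left _
  have hbound : ∀ m, ∀ y ∈ Ioo (t / 2) (2 * t),
      ‖a m * (α * m * fracMonomial α m y / y)‖ ≤ u m := by
    intro m y hy
    have hy0 : 0 < y := by linarith [hy.1]
    have h1 := fracMonomial_nonneg hα hy0.le m
    rw [norm_mul, Real.norm_eq_abs, Real.norm_of_nonneg (by positivity)]
    have h2 := fracMonomial_mono hα m hy0.le hy.2.le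
    calc |a m| * (α * m * fracMonomial α m y / y)
        = α / y * (|(m : ℝ) * a m| * fracMonomial α m y) := by
          rw [abs_mul, Nat.abs_cast]; ring
      _ ≤ u m := by
          have := hy.1.le
          simp only [u]
          gcongr
  have hmem : t ∈ Ioo (t / 2) (2 * t) := ⟨by linarith, by linarith⟩
  have h := hasDerivAt_tsum_of_isPreconnected (g := fun m y => a m * fracMonomial α m y)
    (g' := fun m y => a m * (α * m * fracMonomial α m y / y)) hu isOpen_Ioo isPreconnected_Ioo
    (fun m y hy => (hasDerivAt_fracMonomial α m (by linarith [hy.1])).const_mul (a m)) hbound hmem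
    (ha.summable hα ht.le) hmem
  refine HasDerivAt.congr_deriv h ?_
  have hs : Summable fun m => a m * (α * m * fracMonomial α m t / t) :=
    Summable.of_norm_bounded hu fun m => hbound m t hmem
  rw [hs.tsum_eq_zero_add]
  simp only [Nat.cast_zero, mul_zero, zero_mul, zero_div, zero_add]
  exact tsum_congr fun m => by rw [fracMonomial_succ_deriv hα m ht]

lemma ExpBounded.hasDerivAt_fracSeries_one {a : ℕ → ℝ} (ha : ExpBounded a) {t : ℝ} (ht : 0 < t) :
    HasDerivAt (fracSeries 1 a) (fracSeries 1 (fun m => a (m + 1)) t) t := by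
  refine (ha.hasDerivAt_fracSeries one_pos ht).congr_deriv ?_
  refine tsum_congr fun m => ?_
  rw [fracMonomial]
  push_cast
  ring_nf

/-- The Caputo derivative of order `α` shifts the coefficients of a fractional power series. -/
lemma ExpBounded.hasCaputoDerivAt {α : ℝ} {a : ℕ → ℝ} (ha : ExpBounded a) (hα : 0 < α)
    (hα1 : α ≤ 1) {f : ℝ → ℝ} (hf : ∀ t, 0 ≤ t → f t = fracSeries α a t) {t : ℝ} (ht : 0 < t) :
    HasCaputoDerivAt α f (fracSeries α (fun m => a (m + 1)) t) t := by
  have hcont : ContinuousOn f (Icc 0 t) :=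
    (ha.continuousOn_fracSeries hα t).congr fun x hx => hf x hx.1
  have hev : ∀ u, 0 < u → f =ᶠ[𝓝 u] fracSeries α a := fun u hu => by
    filter_upwards [lt_mem_nhds hu] with x hx using hf x hx.le
  unfold HasCaputoDerivAt
  split_ifs with h1
  · subst h1
    exact ⟨hcont, (ha.hasDerivAt_fracSeries_one ht).congr_of_eventuallyEq (hev t ht)⟩
  have hα' : 0 < 1 - α := by
    have := lt_of_le_of_ne hα1 h1
    linarith
  have hderiv : ∀ u, 0 < u → HasDerivAt f
      (∑' m, a (m + 1) * (u ^ (α * (m + 1 : ℕ) - 1) / Real.Gamma (α * (m + 1 : ℕ)))) u :=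
    fun u hu => (ha.hasDerivAt_fracSeries hα hu).congr_of_eventuallyEq (hev u hu)
  set F : ℕ → ℝ → ℝ := fun m u => a (m + 1) / Real.Gamma (α * (m + 1 : ℕ)) *
    ((t - u) ^ (1 - α - 1) * u ^ (α * (m + 1 : ℕ) - 1)) with hF
  have hpos : ∀ m : ℕ, 0 < α * ((m + 1 : ℕ) : ℝ) := fun m => by positivity
  have hFint : ∀ m, IntegrableOn (F m) (Ioo 0 t) := fun m =>
    (integrableOn_rpow_mul_rpow hα' (hpos m) ht).const_mul _
  -- The beta parameters 1 - α and α(m+1) add up to αm + 1, so the kernel sends the derivative of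
  -- the monomial of index m+1 to the monomial of index m. This is the shift.
  have hbeta : ∀ m : ℕ, ∫ u in Ioo 0 t, (t - u) ^ (1 - α - 1) * u ^ (α * (m + 1 : ℕ) - 1) =
      Real.Gamma (1 - α) * Real.Gamma (α * (m + 1 : ℕ)) * fracMonomial α m t := fun m => by
    rw [integral_rpow_mul_rpow hα' (hpos m) ht, fracMonomial]
    push_cast
    ring_nf
  have hFval : ∀ m, ∫ u in Ioo 0 t, F m u =
      Real.Gamma (1 - α) * (a (m + 1) * fracMonomial α m t) := fun m => by
    have := Real.Gamma_pos_of_pos (hpos m)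
    rw [hF, integral_const_mul, hbeta]
    field_simp
  have hFnorm : ∀ m, ∫ u in Ioo 0 t, ‖F m u‖ =
      Real.Gamma (1 - α) * (|a (m + 1)| * fracMonomial α m t) := fun m => by
    have hG := Real.Gamma_pos_of_pos (hpos m)
    have : ∀ u ∈ Ioo 0 t, ‖F m u‖ = |a (m + 1)| / Real.Gamma (α * (m + 1 : ℕ)) *
        ((t - u) ^ (1 - α - 1) * u ^ (α * (m + 1 : ℕ) - 1)) := fun u hu => by
      have h1 : 0 < t - u := by linarith [hu.2]
      have h2 : 0 < u := hu.1
      rw [hF, norm_mul, norm_div, Real.norm_eq_abs, Real.norm_of_nonneg hG.le,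
        Real.norm_of_nonneg (by positivity)]
    rw [setIntegral_congr_fun measurableSet_Ioo this, integral_const_mul, hbeta]
    field_simp
  have hsum : Summable fun m => ∫ u in Ioo 0 t, ‖F m u‖ := by
    simp_rw [hFnorm]
    exact (ha.shift.summable_abs hα ht.le).mul_left _
  have hcongr : EqOn (fun u => (t - u) ^ (-α) * deriv f u) (fun u => ∑' m, F m u) (Ioo 0 t) := by
    intro u hu
    simp only [hF]
    rw [(hderiv u hu.1).deriv, ← tsum_mul_left]
    refine tsum_congr fun m => ?_
    rw [show 1 - α - 1 = -α by ring]
    ring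
  refine ⟨hcont, fun u hu => (hderiv u hu.1).differentiableAt, ?_, ?_⟩
  · exact IntegrableOn.congr_fun (integrable_tsum_of_summable_integral_norm hFint hsum)
      (fun u hu => (hcongr hu).symm) measurableSet_Ioo
  · rw [setIntegral_congr_fun measurableSet_Ioo hcongr,
      ← integral_tsum_of_summable_integral_norm hFint hsum]
    simp_rw [hFval]
    have := Real.Gamma_pos_of_pos hα'
    rw [tsum_mul_left, fracSeries]
    field_simp

/-! ### Coefficient arrays of the renewal process. -/

/-- Coefficients of the distribution function of the `n`-th partial sum of Mittag-Leffler
variables, i.e. of the power series `(x / (1 + x)) ^ n`. -/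
def renewalCoeff : ℕ → ℕ → ℝ
  | 0, 0 => 1
  | 0, _ + 1 => 0
  | _ + 1, 0 => 0
  | n + 1, m + 1 => (-1) ^ (m + n) * (m.choose n : ℝ)

/-- Coefficients of the probability of exactly `n` renewals. -/
def countCoeff (n m : ℕ) : ℝ := (-1) ^ (m + n) * (m.choose n : ℝ)

/-- In generating functions: (x/(1+x))^n - (x/(1+x))^{n+1} = x^n/(1+x)^{n+1}. -/
lemma renewalCoeff_sub_succ (n m : ℕ) :
    renewalCoeff n m - renewalCoeff (n + 1) m = countCoeff n m := by
  rcases n with _ | n <;> rcases m with _ | m <;>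
    simp [renewalCoeff, countCoeff, Nat.choose_succ_succ] <;> ring

lemma renewalCoeff_succ_succ (n m : ℕ) :
    renewalCoeff (n + 1) (m + 1) = renewalCoeff n m - renewalCoeff (n + 1) m := by
  rw [renewalCoeff_sub_succ]; rfl

lemma renewalCoeff_one_succ (m : ℕ) : renewalCoeff 1 (m + 1) = (-1) ^ m := by
  simp [renewalCoeff]

/-- Coefficient form of (x/(1+x))^n · x/(1+x) = (x/(1+x))^{n+1}; the induction on k uses (1+x) ·
x/(1+x) = x. -/
lemma sum_antidiagonal_renewalCoeff (n k : ℕ) :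
    ∑ q ∈ Finset.HasAntidiagonal.antidiagonal k, renewalCoeff n q.1 * renewalCoeff 1 q.2 =
      renewalCoeff (n + 1) k := by
  induction k with
  | zero => simp [renewalCoeff]
  | succ k ih =>
    rw [Finset.Nat.sum_antidiagonal_succ', renewalCoeff_succ_succ, ← ih]
    simp only [renewalCoeff_succ_succ 0, mul_sub, Finset.sum_sub_distrib]
    -- The last factor has been split as δ_{j0} minus its predecessor. The δ part selects the single
    -- pair (k, 0); the other part is the induction hypothesis.
    rw [show renewalCoeff 1 0 = 0 from rfl, mul_zero, zero_add]
    congr 1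
    rw [Finset.sum_eq_single (k, 0)]
    · simp [renewalCoeff]
    · rintro ⟨i, j⟩ hij hne
      rcases j with _ | j
      · simp at hij; simp [hij] at hne
      · simp [renewalCoeff]
    · simp

lemma abs_renewalCoeff_le (n m : ℕ) : |renewalCoeff n m| ≤ 2 ^ m := by
  rcases n with _ | n <;> rcases m with _ | m
  · simp [renewalCoeff]
  · simp [renewalCoeff]
  · simp [renewalCoeff]
  · rw [renewalCoeff, abs_mul, abs_pow, abs_neg, abs_one, one_pow, one_mul, Nat.abs_cast]
    calc (m.choose n : ℝ) ≤ 2 ^ m := by exact_mod_cast Nat.choose_le_two_pow m n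
      _ ≤ 2 ^ (m + 1) := by gcongr <;> norm_num

lemma expBounded_renewalCoeff (n : ℕ) : ExpBounded (renewalCoeff n) :=
  ⟨1, 2, by norm_num, by norm_num, fun m => by simpa using abs_renewalCoeff_le n m⟩

lemma ExpBounded.sub {a b : ℕ → ℝ} (ha : ExpBounded a) (hb : ExpBounded b) :
    ExpBounded fun m => a m - b m := by
  obtain ⟨K, C, hK, hC, h⟩ := ha
  obtain ⟨K', C', hK', hC', h'⟩ := hb
  refine ⟨K + K', max C C', by positivity, le_max_of_le_left hC, fun m => ?_⟩
  calc |a m - b m| ≤ K * C ^ m + K' * C' ^ m := (abs_sub _ _).trans (add_le_add (h m) (h' m))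
    _ ≤ K * max C C' ^ m + K' * max C C' ^ m := by
        gcongr
        · exact le_max_left _ _
        · exact le_max_right _ _
    _ = _ := by ring

lemma fracSeries_sub {α : ℝ} {a b : ℕ → ℝ} (ha : ExpBounded a) (hb : ExpBounded b) (hα : 0 < α)
    {t : ℝ} (ht : 0 ≤ t) :
    fracSeries α (fun m => a m - b m) t = fracSeries α a t - fracSeries α b t := by
  rw [fracSeries, fracSeries, fracSeries, ← (ha.summable hα ht).tsum_sub (hb.summable hα ht)]
  exact tsum_congr fun m => sub_mul _ _ _

lemma fracSeries_renewalCoeff_zero (α t : ℝ) : fracSeries α (renewalCoeff 0) t = 1 := by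
  rw [fracSeries, tsum_eq_single 0]
  · simp [renewalCoeff, fracMonomial_zero]
  · intro m hm
    obtain ⟨k, rfl⟩ := Nat.exists_eq_succ_of_ne_zero hm
    simp [renewalCoeff]

lemma fracSeries_renewalCoeff_one {α t : ℝ} (hα : 0 < α) (ht : 0 ≤ t) :
    fracSeries α (renewalCoeff 1) t = 1 - mittagLeffler α 1 (-(t ^ α)) := by
  rw [mittagLeffler_eq_fracSeries ht]
  have h0 := fracSeries_sub (b := fun m => (-1) ^ m) (expBounded_renewalCoeff 0)
    ⟨1, 1, by simp⟩ hα ht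
  rw [fracSeries_renewalCoeff_zero] at h0
  rw [← h0]
  congr 1
  ext m
  have := renewalCoeff_sub_succ 0 m
  simp only [countCoeff, Nat.choose_zero_right, Nat.cast_one, mul_one, add_zero, zero_add] at this
  linarith

lemma fracSeries_at_zero {α : ℝ} (hα : 0 < α) (a : ℕ → ℝ) : fracSeries α a 0 = a 0 := by
  rw [fracSeries, tsum_eq_single 0]
  · simp [fracMonomial_zero]
  · intro m hm
    rw [fracMonomial, Real.zero_rpow (by positivity)]
    simp

/-! ### Fractional integration and Cauchy products. -/

/-- The fractional integral of order `α m` of a fractional monomial. -/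
lemma integral_rpow_mul_fracMonomial {α t : ℝ} (hα : 0 < α) (ht : 0 < t) {m : ℕ} (hm : m ≠ 0)
    (j : ℕ) :
    ∫ y in Ioo 0 t, (t - y) ^ (α * m - 1) / Real.Gamma (α * m) * fracMonomial α j y =
      fracMonomial α (m + j) t := by
  have h1 : 0 < α * m := by positivity
  have h2 : 0 < α * j + 1 := by positivity
  have hb := integral_rpow_mul_rpow h1 h2 ht
  have e : ∀ y : ℝ, (t - y) ^ (α * m - 1) / Real.Gamma (α * m) * fracMonomial α j y =
      1 / (Real.Gamma (α * m) * Real.Gamma (α * j + 1)) *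
        ((t - y) ^ (α * m - 1) * y ^ (α * j + 1 - 1)) := fun y => by
    rw [fracMonomial, add_sub_cancel_right]
    field_simp
  simp_rw [e]
  rw [integral_const_mul, hb, fracMonomial]
  have := Real.Gamma_pos_of_pos h1
  have := Real.Gamma_pos_of_pos h2
  push_cast
  rw [show α * m + (α * j + 1) - 1 = α * (m + j) by ring,
    show α * m + (α * j + 1) = α * (m + j) + 1 by ring]
  field_simp

lemma integrableOn_rpow_mul_fracMonomial {α t : ℝ} (hα : 0 < α) (ht : 0 < t) {m : ℕ} (hm : m ≠ 0)
    (j : ℕ) :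
    IntegrableOn (fun y => (t - y) ^ (α * m - 1) / Real.Gamma (α * m) * fracMonomial α j y)
      (Ioo 0 t) := by
  refine Integrable.of_integral_ne_zero ?_
  rw [integral_rpow_mul_fracMonomial hα ht hm, fracMonomial]
  have : 0 < Real.Gamma (α * (m + j : ℕ) + 1) := Real.Gamma_pos_of_pos (by positivity)
  positivity

/-- The k-th antidiagonal consists of k+1 equal terms, and (k+1) D^k ≤ (2D)^k is still exponentially
bounded. -/
lemma summable_prod_pow_mul_fracMonomial {α t : ℝ} (hα : 0 < α) (ht : 0 ≤ t) {D : ℝ}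
    (hD : 0 ≤ D) :
    Summable fun q : ℕ × ℕ => D ^ (q.1 + q.2) * fracMonomial α (q.1 + q.2) t := by
  rw [← Finset.HasAntidiagonal.sigmaAntidiagonalEquivProd.summable_iff]
  rw [summable_sigma_of_nonneg]
  · refine ⟨fun k => (hasSum_fintype _).summable, ?_⟩
    have hb : ExpBounded fun k => ((k : ℝ) + 1) * D ^ k := by
      refine ⟨1, 2 * D, by norm_num, by positivity, fun k => ?_⟩
      rw [abs_of_nonneg (by positivity), one_mul, mul_pow]
      refine mul_le_mul_of_nonneg_right ?_ (by positivity)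
      exact_mod_cast Nat.lt_two_pow_self
    refine (hb.summable hα ht).congr fun k => ?_
    rw [tsum_fintype]
    have : ∀ x : Finset.HasAntidiagonal.antidiagonal k, ((fun q : ℕ × ℕ => D ^ (q.1 + q.2) *
        fracMonomial α (q.1 + q.2) t) ∘ Finset.HasAntidiagonal.sigmaAntidiagonalEquivProd) ⟨k, x⟩ =
        D ^ k * fracMonomial α k t := fun x => by
      have := Finset.HasAntidiagonal.mem_antidiagonal.1 x.2
      simp [Finset.HasAntidiagonal.sigmaAntidiagonalEquivProd, this]
    rw [Finset.sum_congr rfl fun x _ => this x]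
    simp
    ring
  · intro x
    exact mul_nonneg (by positivity) (fracMonomial_nonneg hα ht _)

/-- Cauchy product of two fractional power series. -/
lemma hasSum_cauchy_product {α t : ℝ} (hα : 0 < α) (ht : 0 ≤ t) {a b : ℕ → ℝ} {D : ℝ} (hD : 0 ≤ D)
    (ha : ∀ m, |a m| ≤ D ^ m) (hb : ∀ m, |b m| ≤ D ^ m) :
    HasSum (fun m => a m * ∑' j, b j * fracMonomial α (m + j) t)
      (fracSeries α (fun k => ∑ q ∈ Finset.HasAntidiagonal.antidiagonal k, a q.1 * b q.2) t) := by
  have hs : Summable fun q : ℕ × ℕ => a q.1 * b q.2 * fracMonomial α (q.1 + q.2) t := by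
    refine Summable.of_norm_bounded (summable_prod_pow_mul_fracMonomial hα ht hD) fun q => ?_
    rw [norm_mul, norm_mul, Real.norm_of_nonneg (fracMonomial_nonneg hα ht _), pow_add]
    exact mul_le_mul_of_nonneg_right (mul_le_mul (ha _) (hb _) (abs_nonneg _) (by positivity))
      (fracMonomial_nonneg hα ht _)
  have h1 := hs.hasSum.prod_fiberwise fun m => (hs.prod_factor m).hasSum
  have h2 : ∑' q : ℕ × ℕ, a q.1 * b q.2 * fracMonomial α (q.1 + q.2) t =
      fracSeries α (fun k => ∑ q ∈ Finset.HasAntidiagonal.antidiagonal k, a q.1 * b q.2) t := by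
    rw [← Finset.HasAntidiagonal.sigmaAntidiagonalEquivProd.tsum_eq]
    erw [Summable.tsum_sigma (Finset.HasAntidiagonal.sigmaAntidiagonalEquivProd.summable_iff.2 hs)]
    rw [fracSeries]
    refine tsum_congr fun k => ?_
    rw [tsum_fintype, Finset.sum_mul, ← Finset.sum_coe_sort (Finset.HasAntidiagonal.antidiagonal k)]
    refine Finset.sum_congr rfl fun x _ => ?_
    have := Finset.HasAntidiagonal.mem_antidiagonal.1 x.2
    simp [Finset.HasAntidiagonal.sigmaAntidiagonalEquivProd, this]
  rw [h2] at h1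
  refine h1.congr_fun fun m => ?_
  rw [← tsum_mul_left]
  exact tsum_congr fun j => by ring

/-- The fractional integral of order `α m` of a fractional power series. -/
lemma integral_rpow_mul_fracSeries {α t : ℝ} (hα : 0 < α) (ht : 0 < t) {m : ℕ} (hm : m ≠ 0)
    {b : ℕ → ℝ} {D : ℝ} (hD : 0 ≤ D) (hb : ∀ m, |b m| ≤ D ^ m) :
    ∫ y in Ioo 0 t, (t - y) ^ (α * m - 1) / Real.Gamma (α * m) * fracSeries α b y =
      ∑' j, b j * fracMonomial α (m + j) t := by
  set F : ℕ → ℝ → ℝ := fun j y =>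
    b j * ((t - y) ^ (α * m - 1) / Real.Gamma (α * m) * fracMonomial α j y) with hF
  have hG : 0 < Real.Gamma (α * m) := Real.Gamma_pos_of_pos (by positivity)
  have hFint : ∀ j, IntegrableOn (F j) (Ioo 0 t) := fun j =>
    (integrableOn_rpow_mul_fracMonomial hα ht hm j).const_mul _
  have hnorm : ∀ j, ∫ y in Ioo 0 t, ‖F j y‖ = |b j| * fracMonomial α (m + j) t := fun j => by
    rw [← integral_rpow_mul_fracMonomial hα ht hm, ← integral_const_mul]
    refine setIntegral_congr_fun measurableSet_Ioo fun y hy => ?_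
    have h1 : 0 < t - y := by linarith [hy.2]
    have h2 := fracMonomial_nonneg hα hy.1.le j
    simp only [hF]
    rw [norm_mul, Real.norm_eq_abs, Real.norm_of_nonneg (by positivity)]
  have hsum : Summable fun j => ∫ y in Ioo 0 t, ‖F j y‖ := by
    simp_rw [hnorm]
    -- Passing from D to max D 1 makes the powers monotone, so that D^j is dominated by the (m+j)-th
    -- power on the row m of the double series.
    have hp := (summable_prod_pow_mul_fracMonomial hα ht.le
      (le_max_of_le_left hD : 0 ≤ max D 1)).prod_factor m
    refine Summable.of_nonneg_of_le (fun j => mul_nonneg (abs_nonneg _)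
      (fracMonomial_nonneg hα ht.le _)) (fun j => ?_) hp
    refine mul_le_mul_of_nonneg_right ?_ (fracMonomial_nonneg hα ht.le _)
    calc |b j| ≤ D ^ j := hb j
      _ ≤ max D 1 ^ j := by gcongr; exact le_max_left _ _
      _ ≤ max D 1 ^ (m + j) := pow_le_pow_right₀ (le_max_right _ _) (by omega)
  have h := integral_tsum_of_summable_integral_norm hFint hsum
  simp_rw [hF, integral_const_mul, integral_rpow_mul_fracMonomial hα ht hm] at h
  rw [h]
  refine integral_congr_ae (ae_of_all _ fun y => ?_)
  simp only [fracSeries]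
  rw [← tsum_mul_left]
  exact tsum_congr fun j => by ring

/-! ### Iterated differences and averages over the counting process. -/

/-- Newton's formula; the signs agree because m - n and m + n have the same parity. -/
lemma fwdDiff_iter_zero_eq (b : ℕ → ℝ) (m : ℕ) :
    (fwdDiff 1)^[m] b 0 = ∑ n ∈ Finset.range (m + 1), countCoeff n m * b n := by
  rw [fwdDiff_iter_eq_sum_shift]
  refine Finset.sum_congr rfl fun n hn => ?_
  have hn : n ≤ m := by simpa [Nat.lt_succ_iff] using hn
  rw [countCoeff, zsmul_eq_mul]
  push_cast
  congr 2
  · rw [show m + n = m - n + 2 * n by omega, pow_add, pow_mul]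
    simp
  · simp

lemma countCoeff_of_lt {n m : ℕ} (h : m < n) : countCoeff n m = 0 := by
  simp [countCoeff, Nat.choose_eq_zero_of_lt h]

lemma abs_countCoeff (n m : ℕ) : |countCoeff n m| = m.choose n := by
  simp [countCoeff, abs_mul]

/-- The binomial theorem. It turns a bound W^n on a sequence into the bound (W+1)^m on its
differences, and it controls the double series in the exchange of sums over n and m. -/
lemma sum_abs_countCoeff_mul (W : ℝ) (m : ℕ) :
    ∑ n ∈ Finset.range (m + 1), |countCoeff n m| * W ^ n = (W + 1) ^ m := by
  rw [add_pow]
  refine Finset.sum_congr rfl fun n _ => ?_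
  rw [abs_countCoeff, one_pow]; ring

lemma ExpBounded.fwdDiff_iter {b : ℕ → ℝ} (hb : ExpBounded b) :
    ExpBounded fun m => (fwdDiff 1)^[m] b 0 := by
  obtain ⟨K, C, hK, hC, h⟩ := hb
  refine ⟨K, C + 1, hK, by positivity, fun m => ?_⟩
  beta_reduce
  rw [fwdDiff_iter_zero_eq, ← sum_abs_countCoeff_mul, Finset.mul_sum]
  refine (Finset.abs_sum_le_sum_abs _ _).trans (Finset.sum_le_sum fun n _ => ?_)
  rw [abs_mul]
  calc |countCoeff n m| * |b n| ≤ |countCoeff n m| * (K * C ^ n) := by gcongr; exact h n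
    _ = _ := by ring

/-- Averaging an exponentially bounded sequence against the weights of the fractional counting
process yields the fractional power series of its iterated differences. -/
lemma ExpBounded.hasSum_countCoeff {α t : ℝ} (hα : 0 < α) (ht : 0 ≤ t) {b : ℕ → ℝ}
    (hb : ExpBounded b) :
    HasSum (fun n => fracSeries α (countCoeff n) t * b n)
      (fracSeries α (fun m => (fwdDiff 1)^[m] b 0) t) := by
  have hfin : ∀ (m : ℕ) (φ : ℕ → ℝ), HasSum (fun n => countCoeff n m * φ n)
      (∑ n ∈ Finset.range (m + 1), countCoeff n m * φ n) := fun m φ =>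
    hasSum_sum_of_ne_finset_zero fun n hn => by
      rw [countCoeff_of_lt (by simpa using hn), zero_mul]
  have hs : Summable fun q : ℕ × ℕ => countCoeff q.2 q.1 * (b q.2 * fracMonomial α q.1 t) := by
    obtain ⟨K, C, hK, hC, h⟩ := hb
    have hfin' : ∀ m, HasSum (fun n => |countCoeff n m| * (K * C ^ n * fracMonomial α m t))
        (K * (C + 1) ^ m * fracMonomial α m t) := fun m => by
      rw [← sum_abs_countCoeff_mul, Finset.mul_sum, Finset.sum_mul]
      rw [Finset.sum_congr rfl fun n _ => show K * (|countCoeff n m| * C ^ n) * fracMonomial α m t =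
        |countCoeff n m| * (K * C ^ n * fracMonomial α m t) by ring]
      refine hasSum_sum_of_ne_finset_zero fun n hn => ?_
      rw [countCoeff_of_lt (by simpa using hn), abs_zero, zero_mul]
    have hs' : Summable fun q : ℕ × ℕ =>
        |countCoeff q.2 q.1| * (K * C ^ q.2 * fracMonomial α q.1 t) := by
      rw [summable_prod_of_nonneg]
      · refine ⟨fun m => (hfin' m).summable, ?_⟩
        simp_rw [fun m => (hfin' m).tsum_eq, mul_assoc]
        exact (summable_pow_mul_fracMonomial hα _ ht).mul_left K
      · intro q
        have := fracMonomial_nonneg hα ht q.1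
        simp only [Pi.zero_apply]
        positivity
    refine Summable.of_norm_bounded hs' fun q => ?_
    rw [norm_mul, norm_mul, Real.norm_of_nonneg (fracMonomial_nonneg hα ht q.1)]
    exact mul_le_mul_of_nonneg_left (mul_le_mul_of_nonneg_right (h _)
      (fracMonomial_nonneg hα ht _)) (abs_nonneg _)
  have h1 := hs.prod_symm.hasSum.prod_fiberwise fun n => (hs.prod_symm.prod_factor n).hasSum
  have h2 : ∑' q : ℕ × ℕ, countCoeff q.swap.2 q.swap.1 * (b q.swap.2 * fracMonomial α q.swap.1 t)
      = fracSeries α (fun m => (fwdDiff 1)^[m] b 0) t := by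
    refine ((Equiv.prodComm ℕ ℕ).tsum_eq
      (fun q : ℕ × ℕ => countCoeff q.2 q.1 * (b q.2 * fracMonomial α q.1 t))).trans ?_
    rw [hs.tsum_prod]
    refine tsum_congr fun m => ?_
    beta_reduce
    rw [(hfin m _).tsum_eq, fwdDiff_iter_zero_eq, Finset.sum_mul]
    exact Finset.sum_congr rfl fun n _ => by ring
  rw [h2] at h1
  refine h1.congr_fun fun n => ?_
  rw [fracSeries, ← tsum_mul_right]
  exact tsum_congr fun m => by simp; ring

/-! ### Distribution functions of the partial sums. -/

section Renewal

variable {Ω : Type*} [MeasurableSpace Ω] {μ : Measure Ω}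

/-- Integration of the tail of a weight over the law of a nonnegative random variable. -/
lemma lintegral_setLIntegral_Ici [SFinite μ] {X : Ω → ℝ} (hX : Measurable X)
    (hpos : ∀ᵐ ω ∂μ, 0 ≤ X ω) {w : ℝ → ENNReal} (hw : Measurable w) :
    ∫⁻ ω, (∫⁻ y in Ici (X ω), w y) ∂μ = ∫⁻ y in Ioi (0 : ℝ), w y * μ {ω | X ω ≤ y} := by
  have hmeas : MeasurableSet {q : Ω × ℝ | X q.1 ≤ q.2} :=
    measurableSet_le (hX.comp measurable_fst) measurable_snd
  rw [setLIntegral_congr (Ioi_ae_eq_Ici (a := (0 : ℝ)))]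
  calc ∫⁻ ω, (∫⁻ y in Ici (X ω), w y) ∂μ
      = ∫⁻ ω, (∫⁻ y in Ici (0 : ℝ),
          {q : Ω × ℝ | X q.1 ≤ q.2}.indicator (fun q => w q.2) (ω, y)) ∂μ := by
        refine lintegral_congr_ae ?_
        filter_upwards [hpos] with ω hω
        have : (fun y => {q : Ω × ℝ | X q.1 ≤ q.2}.indicator (fun q => w q.2) (ω, y)) =
            (Ici (X ω)).indicator w := by
          ext y; simp [indicator]
        rw [this, lintegral_indicator measurableSet_Ici, Measure.restrict_restrict measurableSet_Ici,
          inter_eq_left.2 (Ici_subset_Ici.2 hω)]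
    _ = ∫⁻ y in Ici (0 : ℝ),
          ∫⁻ ω, {q : Ω × ℝ | X q.1 ≤ q.2}.indicator (fun q => w q.2) (ω, y) ∂μ :=
        lintegral_lintegral_swap ((hw.comp measurable_snd).indicator hmeas).aemeasurable
    _ = _ := by
        refine lintegral_congr fun y => ?_
        have : (fun ω => {q : Ω × ℝ | X q.1 ≤ q.2}.indicator (fun q => w q.2) (ω, y)) =
            {ω | X ω ≤ y}.indicator fun _ => w y := by
          ext ω; simp [indicator]
        rw [this, lintegral_indicator_const (measurableSet_le hX measurable_const)]

lemma lintegral_Ioo_rpow {a x t : ℝ} (ha : 0 < a) (hx : x ≤ t) :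
    ∫⁻ y in Ioo x t, ENNReal.ofReal ((t - y) ^ (a - 1) / Real.Gamma a) =
      ENNReal.ofReal ((t - x) ^ a / Real.Gamma (a + 1)) := by
  have hG := Real.Gamma_pos_of_pos ha
  rcases hx.eq_or_lt with rfl | hlt
  · simp [Real.zero_rpow ha.ne']
  have hval : ∫ y in Ioo x t, (t - y) ^ (a - 1) / Real.Gamma a =
      (t - x) ^ a / Real.Gamma (a + 1) := by
    rw [← integral_Ioc_eq_integral_Ioo, ← intervalIntegral.integral_of_le hx,
      intervalIntegral.integral_comp_sub_left (fun u => u ^ (a - 1) / Real.Gamma a),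
      intervalIntegral.integral_div, integral_rpow (Or.inl (by linarith)), Real.Gamma_add_one ha.ne',
      sub_self, sub_add_cancel, Real.zero_rpow ha.ne']
    field_simp
    ring
  rw [← hval, ofReal_integral_eq_lintegral_ofReal]
  · refine Integrable.of_integral_ne_zero ?_
    rw [hval]
    have := Real.Gamma_pos_of_pos (show 0 < a + 1 by linarith)
    have : 0 < t - x := by linarith
    positivity
  · filter_upwards [ae_restrict_mem measurableSet_Ioo] with y hy
    have : 0 < t - y := by linarith [hy.2]
    simp only [Pi.zero_apply]
    positivity

/-- Expectation of a truncated power `(t - X)₊ ^ a`. -/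
lemma integral_truncated_rpow [IsProbabilityMeasure μ] {X : Ω → ℝ} (hX : Measurable X)
    (hpos : ∀ᵐ ω ∂μ, 0 < X ω) {a t : ℝ} (ha : 0 < a) :
    ∫ ω, {ω | X ω ≤ t}.indicator (fun ω => (t - X ω) ^ a / Real.Gamma (a + 1)) ω ∂μ =
      ∫ y in Ioo 0 t, (t - y) ^ (a - 1) / Real.Gamma a * μ.real {ω | X ω ≤ y} := by
  have hG := Real.Gamma_pos_of_pos ha
  have hG1 := Real.Gamma_pos_of_pos (show 0 < a + 1 by linarith)
  have hms : MeasurableSet {ω | X ω ≤ t} := measurableSet_le hX measurable_const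
  have hcdf : Measurable fun y => μ.real {ω | X ω ≤ y} := by
    refine Monotone.measurable fun y y' hy => ?_
    exact measureReal_mono fun ω (hω : X ω ≤ y) => hω.trans hy
  -- The truncated power is the integral of this kernel over [X, t), so Tonelli moves the
  -- expectation onto the distribution function of X.
  set w : ℝ → ENNReal := (Iio t).indicator fun y => ENNReal.ofReal ((t - y) ^ (a - 1) / Real.Gamma a)
    with hw
  have hwm : Measurable w := by
    refine Measurable.indicator ?_ measurableSet_Iio
    fun_prop
  have h := lintegral_setLIntegral_Ici hX (hpos.mono fun ω h => h.le) hwm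
  rw [integral_eq_lintegral_of_nonneg_ae, integral_eq_lintegral_of_nonneg_ae]
  · congr 1
    convert h using 1
    · refine lintegral_congr fun ω => ?_
      rw [hw, setLIntegral_indicator measurableSet_Iio, inter_comm, Ici_inter_Iio]
      by_cases hω : X ω ≤ t
      · rw [indicator_of_mem (by exact hω), setLIntegral_congr Ioo_ae_eq_Ico.symm,
          lintegral_Ioo_rpow ha hω]
      · rw [indicator_of_notMem (by exact hω), Ico_eq_empty (fun h => hω h.le)]
        simp
    · have : (fun y => w y * μ {ω | X ω ≤ y}) = (Iio t).indicator fun y =>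
          ENNReal.ofReal ((t - y) ^ (a - 1) / Real.Gamma a) * μ {ω | X ω ≤ y} := by
        ext y
        by_cases hy : y ∈ Iio t <;> simp [hw, hy]
      rw [this, setLIntegral_indicator measurableSet_Iio, inter_comm, Ioi_inter_Iio]
      refine setLIntegral_congr_fun measurableSet_Ioo fun y hy => ?_
      have : 0 < t - y := by linarith [hy.2]
      rw [ENNReal.ofReal_mul (by positivity), ofReal_measureReal]
  · filter_upwards [ae_restrict_mem measurableSet_Ioo] with y hy
    have : 0 < t - y := by linarith [hy.2]
    simp only [Pi.zero_apply]
    positivity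
  · refine Measurable.aestronglyMeasurable ?_
    fun_prop
  · refine ae_of_all _ fun ω => indicator_nonneg (fun ω hω => ?_) _
    have : 0 ≤ t - X ω := sub_nonneg.2 hω
    positivity
  · refine (Measurable.indicator ?_ hms).aestronglyMeasurable
    fun_prop

/-- Partial sums of the inter-event times. -/
def partialSum (T : ℕ → Ω → ℝ) (n : ℕ) (ω : Ω) : ℝ := ∑ i ∈ Finset.range n, T i ω

variable {α : ℝ} {T : ℕ → Ω → ℝ}

lemma IsMittagLefflerRenewal.measurable_partialSum (hT : IsMittagLefflerRenewal α T μ) (n : ℕ) :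
    Measurable (partialSum T n) :=
  Finset.measurable_fun_sum _ fun i _ => hT.measurable i

lemma IsMittagLefflerRenewal.cdf_eq (hα : 0 < α) (hT : IsMittagLefflerRenewal α T μ) (n : ℕ) {t : ℝ}
    (ht : 0 ≤ t) : μ.real {ω | T n ω ≤ t} = fracSeries α (renewalCoeff 1) t := by
  rw [hT.law n t ht, fracSeries_renewalCoeff_one hα ht]

lemma IsMittagLefflerRenewal.indepFun_partialSum (hT : IsMittagLefflerRenewal α T μ) (n : ℕ) :
    IndepFun (partialSum T n) (T n) μ := by
  have := hT.indep.indepFun_finsetSum_of_notMem hT.measurable (s := Finset.range n) (i := n)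
    (by simp)
  convert this using 1
  ext ω
  simp [partialSum]

variable [IsProbabilityMeasure μ]

lemma IsMittagLefflerRenewal.ae_pos (hα : 0 < α) (hT : IsMittagLefflerRenewal α T μ) :
    ∀ᵐ ω ∂μ, ∀ n, 0 < T n ω := by
  rw [ae_all_iff]
  intro n
  have h := hT.cdf_eq hα n le_rfl
  rw [fracSeries_at_zero hα, renewalCoeff, measureReal_eq_zero_iff] at h
  rw [ae_iff]
  simpa using h

lemma IsMittagLefflerRenewal.partialSum_nonneg (hα : 0 < α) (hT : IsMittagLefflerRenewal α T μ) :
    ∀ᵐ ω ∂μ, ∀ n, 0 ≤ partialSum T n ω := by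
  filter_upwards [hT.ae_pos hα] with ω hω n
  exact Finset.sum_nonneg fun i _ => (hω i).le

/-- The distribution function of a partial sum satisfies the renewal recursion. -/
lemma IsMittagLefflerRenewal.cdf_partialSum_succ (hT : IsMittagLefflerRenewal α T μ) (n : ℕ)
    (t : ℝ) :
    μ.real {ω | partialSum T (n + 1) ω ≤ t} =
      ∫ ω, μ.real {ω' | partialSum T n ω' ≤ t - T n ω} ∂μ := by
  have hS := hT.measurable_partialSum n
  have hTn := hT.measurable n
  have hprod := (indepFun_iff_map_prod_eq_prod_map_map hS.aemeasurable hTn.aemeasurable).1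
    (hT.indepFun_partialSum n)
  have hset : MeasurableSet {q : ℝ × ℝ | q.1 + q.2 ≤ t} :=
    measurableSet_le (measurable_fst.add measurable_snd) measurable_const
  have h1 : μ {ω | partialSum T (n + 1) ω ≤ t} =
      ∫⁻ ω, μ {ω' | partialSum T n ω' ≤ t - T n ω} ∂μ := by
    have : {ω | partialSum T (n + 1) ω ≤ t} =
        (fun ω => (partialSum T n ω, T n ω)) ⁻¹' {q : ℝ × ℝ | q.1 + q.2 ≤ t} := by
      ext ω
      simp [partialSum, Finset.sum_range_succ]
    have : IsProbabilityMeasure (μ.map (partialSum T n)) :=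
      Measure.isProbabilityMeasure_map hS.aemeasurable
    have : IsProbabilityMeasure (μ.map (T n)) := Measure.isProbabilityMeasure_map hTn.aemeasurable
    rw [‹{ω | _} = _›, ← Measure.map_apply (hS.prodMk hTn) hset, hprod,
      Measure.prod_apply_symm hset, lintegral_map (measurable_measure_prodMk_right hset) hTn]
    refine lintegral_congr fun ω => ?_
    rw [Measure.map_apply hS (measurable_prodMk_right hset)]
    congr 1
    ext ω'
    simp [le_sub_iff_add_le]
  have hm : Antitone fun x => μ {ω' | partialSum T n ω' ≤ t - x} := fun x x' hx =>
    measure_mono fun ω' h => le_trans (mem_ofPred.1 h) (by linarith)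
  rw [Measure.real, h1, ← integral_toReal]
  · rfl
  · exact (hm.measurable.comp hTn).aemeasurable
  · exact ae_of_all _ fun ω => measure_lt_top _ _

/-- The distribution function of the `n`-th partial sum as a fractional power series. -/
lemma IsMittagLefflerRenewal.cdf_partialSum (hα : 0 < α) (hT : IsMittagLefflerRenewal α T μ)
    (n : ℕ) {t : ℝ} (ht : 0 ≤ t) :
    μ.real {ω | partialSum T n ω ≤ t} = fracSeries α (renewalCoeff n) t := by
  have hpos := hT.ae_pos hα
  induction n generalizing t with
  | zero => simp [partialSum, ht, fracSeries_renewalCoeff_zero]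
  | succ n ih =>
    -- With a single summand treated apart, the induction hypothesis only concerns series whose
    -- coefficient of index 0 vanishes, so only fractional integrals of positive order αm occur
    -- below.
    rcases n with _ | n
    · simpa [partialSum] using hT.cdf_eq hα 0 ht
    rcases ht.eq_or_lt with rfl | ht0
    · rw [fracSeries_at_zero hα, renewalCoeff, measureReal_eq_zero_iff]
      have : ∀ᵐ ω ∂μ, ¬ partialSum T (n + 1 + 1) ω ≤ 0 := by
        filter_upwards [hpos] with ω hω
        rw [not_le]
        exact Finset.sum_pos (fun i _ => hω i) (by simp)
      rw [ae_iff] at this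
      simpa using this
    rw [hT.cdf_partialSum_succ]
    set φ : ℕ → Ω → ℝ := fun m =>
      {ω | T (n + 1) ω ≤ t}.indicator fun ω => fracMonomial α m (t - T (n + 1) ω) with hφ
    have hTm := hT.measurable (n + 1)
    have hms : MeasurableSet {ω | T (n + 1) ω ≤ t} := measurableSet_le hTm measurable_const
    have hφ0 : ∀ m ω, 0 ≤ φ m ω := fun m ω =>
      indicator_nonneg (fun ω hω => fracMonomial_nonneg hα (sub_nonneg.2 hω) m) ω
    have hφle : ∀ m, ∀ᵐ ω ∂μ, ‖φ m ω‖ ≤ fracMonomial α m t := fun m => by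
      filter_upwards [hpos] with ω hω
      rw [Real.norm_of_nonneg (hφ0 m ω)]
      by_cases h : T (n + 1) ω ≤ t
      · simp only [hφ, indicator_of_mem (show ω ∈ {ω | T (n + 1) ω ≤ t} from h)]
        exact fracMonomial_mono hα m (sub_nonneg.2 h) (by linarith [hω (n + 1)])
      · simp only [hφ, indicator_of_notMem (show ω ∉ {ω | T (n + 1) ω ≤ t} from h)]
        exact fracMonomial_nonneg hα ht m
    have hφm : ∀ m, Measurable (φ m) := fun m =>
      ((continuous_fracMonomial hα.le m).measurable.comp (measurable_const.sub hTm)).indicator hms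
    have hφint : ∀ m, Integrable (φ m) μ := fun m =>
      (integrable_const (fracMonomial α m t)).mono' (hφm m).aestronglyMeasurable (hφle m)
    have hcongr : ∀ᵐ ω ∂μ, μ.real {ω' | partialSum T (n + 1) ω' ≤ t - T (n + 1) ω} =
        ∑' m, renewalCoeff (n + 1) m * φ m ω := by
      filter_upwards [hpos] with ω hω
      by_cases h : T (n + 1) ω ≤ t
      · rw [ih (sub_nonneg.2 h)]
        simp [hφ, h, fracSeries]
      -- If the last waiting time exceeds t, the series vanishes by truncation and the probability
      -- vanishes because partial sums are almost surely nonnegative.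
      · have h0 : ∀ m, φ m ω = 0 := fun m => indicator_of_notMem (by exact h) _
        simp only [h0, mul_zero, tsum_zero]
        rw [measureReal_eq_zero_iff]
        have hn := hT.partialSum_nonneg hα
        refine measure_mono_null (fun ω' hω' => ?_) (ae_iff.1 hn)
        simp only [mem_ofPred_eq] at hω' ⊢
        intro hh
        have := hh (n + 1)
        linarith
    have hφnorm : ∀ m, ∫ ω, ‖renewalCoeff (n + 1) m * φ m ω‖ ∂μ ≤
        |renewalCoeff (n + 1) m| * fracMonomial α m t := fun m => by
      have := norm_integral_le_of_norm_le_const (hφle m)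
      simp_rw [norm_mul, integral_const_mul, Real.norm_of_nonneg (hφ0 m _)]
      refine mul_le_mul_of_nonneg_left ?_ (abs_nonneg _)
      exact (le_abs_self _).trans (by simpa using this)
    rw [integral_congr_ae hcongr, ← integral_tsum_of_summable_integral_norm
      (fun m => (hφint m).const_mul _)
      (Summable.of_nonneg_of_le (fun m => integral_nonneg fun ω => norm_nonneg _) hφnorm
        ((expBounded_renewalCoeff _).summable_abs hα ht))]
    have hval : ∀ m, ∫ ω, renewalCoeff (n + 1) m * φ m ω ∂μ =
        renewalCoeff (n + 1) m * ∑' j, renewalCoeff 1 j * fracMonomial α (m + j) t := fun m => by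
      rw [integral_const_mul]
      rcases eq_or_ne m 0 with rfl | hm
      · simp [renewalCoeff]
      congr 1
      -- The expectation of a truncated monomial is the order αm fractional integral of the
      -- distribution function of T, which shifts its series by m; summing over m then gives a
      -- Cauchy product.
      rw [← integral_rpow_mul_fracSeries hα ht0 hm zero_le_two (abs_renewalCoeff_le 1)]
      have := integral_truncated_rpow hTm (hpos.mono fun ω h => h (n + 1))
        (show 0 < α * m by positivity) (t := t)
      refine Eq.trans (by rfl) (this.trans ?_)
      refine setIntegral_congr_fun measurableSet_Ioo fun y hy => ?_
      rw [hT.cdf_eq hα _ hy.1.le]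
    simp_rw [hval]
    rw [(hasSum_cauchy_product hα ht zero_le_two (abs_renewalCoeff_le (n + 1))
      (abs_renewalCoeff_le 1)).tsum_eq]
    simp_rw [sum_antidiagonal_renewalCoeff]

end Renewal

/-! ### The counting process and the mixture formula. -/

section Counting

variable {Ω : Type*} [MeasurableSpace Ω] {μ : Measure Ω} {α : ℝ} {T : ℕ → Ω → ℝ}

/-- The event that exactly `n` renewals occur up to time `t`. -/
def countEvent (T : ℕ → Ω → ℝ) (n : ℕ) (t : ℝ) : Set Ω :=
  {ω | partialSum T n ω ≤ t ∧ t < partialSum T (n + 1) ω}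

lemma IsMittagLefflerRenewal.measurableSet_countEvent (hT : IsMittagLefflerRenewal α T μ) (n : ℕ)
    (t : ℝ) : MeasurableSet (countEvent T n t) :=
  (measurableSet_le (hT.measurable_partialSum n) measurable_const).inter
    (measurableSet_lt measurable_const (hT.measurable_partialSum (n + 1)))

lemma strictMono_partialSum {X : Type*} {T : ℕ → X → ℝ} {ω : X} (h : ∀ n, 0 < T n ω) :
    StrictMono fun n => partialSum T n ω :=
  strictMono_nat_of_lt_succ fun n => by
    simp only [partialSum, Finset.sum_range_succ]
    linarith [h n]

lemma countingProcess_eq {X : Type*} {T : ℕ → X → ℝ} {ω : X} (h : ∀ n, 0 < T n ω) {n : ℕ}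
    {t : ℝ} (hn : ω ∈ countEvent T n t) : countingProcess T t ω = n := by
  have : {k : ℕ | ∑ i ∈ Finset.range k, T i ω ≤ t ∧ t < ∑ i ∈ Finset.range (k + 1), T i ω} =
      {n} := by
    ext k
    have hm := strictMono_partialSum h
    constructor
    · intro hk
      have h1 : k < n + 1 := hm.lt_iff_lt.1 (lt_of_le_of_lt hk.1 hn.2)
      have h2 : n < k + 1 := hm.lt_iff_lt.1 (lt_of_le_of_lt hn.1 hk.2)
      exact mem_singleton_iff.2 (by omega)
    · rintro rfl
      exact hn
  rw [countingProcess, this, csSup_singleton]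

variable {Q : ℕ → Ω → ℕ}

lemma measurable_indicator_countEvent_mul (hT : IsMittagLefflerRenewal α T μ)
    (hQ : ∀ n, Measurable (Q n)) (t : ℝ) (φ : ℕ → ENNReal) (n : ℕ) :
    Measurable fun ω => (countEvent T n t).indicator (1 : Ω → ENNReal) ω * φ (Q n ω) :=
  (measurable_one.indicator (hT.measurableSet_countEvent n t)).mul
    ((measurable_from_top (f := φ)).comp (hQ n))

variable [IsProbabilityMeasure μ]

lemma IsMittagLefflerRenewal.measureReal_countEvent_eq_sub (hα : 0 < α)
    (hT : IsMittagLefflerRenewal α T μ) (n : ℕ) (t : ℝ) :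
    μ.real (countEvent T n t) =
      μ.real {ω | partialSum T n ω ≤ t} - μ.real {ω | partialSum T (n + 1) ω ≤ t} := by
  have hS : MeasurableSet {ω | partialSum T (n + 1) ω ≤ t} :=
    measurableSet_le (hT.measurable_partialSum _) measurable_const
  have hdisj : Disjoint (countEvent T n t) {ω | partialSum T (n + 1) ω ≤ t} := by
    rw [Set.disjoint_left]
    intro ω h1 h2
    exact absurd h1.2 (not_lt.2 h2)
  have hae : {ω | partialSum T n ω ≤ t} =ᵐ[μ]
      (countEvent T n t ∪ {ω | partialSum T (n + 1) ω ≤ t} : Set Ω) := by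
    filter_upwards [hT.ae_pos hα] with ω hω
    have hlt := strictMono_partialSum hω n.lt_succ_self
    refine propext ⟨fun h => ?_, fun h => ?_⟩
    · rcases lt_or_ge t (partialSum T (n + 1) ω) with h' | h'
      · exact Or.inl ⟨h, h'⟩
      · exact Or.inr h'
    · rcases h with h | h
      · exact h.1
      · exact hlt.le.trans h
  rw [measureReal_congr hae, measureReal_union hdisj hS]
  ring

lemma IsMittagLefflerRenewal.measureReal_countEvent (hα : 0 < α)
    (hT : IsMittagLefflerRenewal α T μ) (n : ℕ) {t : ℝ} (ht : 0 ≤ t) :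
    μ.real (countEvent T n t) = fracSeries α (countCoeff n) t := by
  rw [hT.measureReal_countEvent_eq_sub hα, hT.cdf_partialSum hα n ht,
    hT.cdf_partialSum hα (n + 1) ht, ← fracSeries_sub (expBounded_renewalCoeff n)
    (expBounded_renewalCoeff (n + 1)) hα ht]
  simp_rw [renewalCoeff_sub_succ]

/-- Averaging the constant sequence 1, whose differences of positive order vanish, shows that the
probabilities of exactly n renewals sum to 1. Their partial sums telescope to 1 - P(S_n ≤ t), so
there is no explosion. -/
lemma IsMittagLefflerRenewal.tendsto_cdf_partialSum (hα : 0 < α)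
    (hT : IsMittagLefflerRenewal α T μ) {t : ℝ} (ht : 0 ≤ t) :
    Tendsto (fun n => μ.real {ω | partialSum T n ω ≤ t}) atTop (𝓝 0) := by
  have hb : ExpBounded fun _ => (1 : ℝ) := ⟨1, 1, by simp⟩
  have h := (hb.hasSum_countCoeff hα ht).tendsto_sum_nat
  have h1 : fracSeries α (fun m => (fwdDiff 1)^[m] (fun _ : ℕ => (1 : ℝ)) 0) t = 1 := by
    refine Eq.trans ?_ (fracSeries_renewalCoeff_zero α t)
    congr 1
    ext m
    rcases m with _ | m
    · simp [renewalCoeff]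
    · rw [Function.iterate_succ_apply, fwdDiff_const, renewalCoeff]
      exact congrFun (Function.iterate_fixed (by ext; simp [fwdDiff]) m) 0
  rw [h1] at h
  have h2 : ∀ n, ∑ i ∈ Finset.range n, fracSeries α (countCoeff i) t * 1 =
      1 - μ.real {ω | partialSum T n ω ≤ t} := fun n => by
    simp_rw [mul_one, ← hT.measureReal_countEvent hα _ ht, hT.measureReal_countEvent_eq_sub hα]
    rw [Finset.sum_range_sub']
    simp [partialSum, ht]
  simp_rw [h2] at h
  simpa using (tendsto_const_nhds (x := (1 : ℝ))).sub h

lemma IsMittagLefflerRenewal.ae_exists_mem_countEvent (hα : 0 < α)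
    (hT : IsMittagLefflerRenewal α T μ) {t : ℝ} (ht : 0 ≤ t) :
    ∀ᵐ ω ∂μ, ∃ n, ω ∈ countEvent T n t := by
  have hnull : μ {ω | ∀ n, partialSum T n ω ≤ t} = 0 := by
    rw [← measureReal_eq_zero_iff]
    refine le_antisymm ?_ measureReal_nonneg
    exact ge_of_tendsto' (hT.tendsto_cdf_partialSum hα ht) fun n =>
      measureReal_mono fun ω hω => mem_ofPred.1 hω n
  have hnull' : ∀ᵐ ω ∂μ, ¬ ∀ n, partialSum T n ω ≤ t := by
    rw [ae_iff]; simpa using hnull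
  filter_upwards [hnull'] with ω hω
  push Not at hω
  classical
  have hf := Nat.find_spec hω
  -- The first partial sum beyond t is not the empty one, which equals 0 ≤ t; its predecessor index
  -- is the number of renewals.
  have h0 : Nat.find hω ≠ 0 := fun h => by
    rw [h] at hf
    simp [partialSum] at hf
    linarith
  obtain ⟨k, hk⟩ := Nat.exists_eq_succ_of_ne_zero h0
  refine ⟨k, not_lt.1 (Nat.find_min hω (m := k) (by omega)), ?_⟩
  rwa [hk] at hf

/-- Almost surely exactly one counting event occurs. The sum form separates a function of T from a
function of Q, so independence can be applied term by term. -/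
lemma ae_comp_queueLength_eq (hα : 0 < α) (hT : IsMittagLefflerRenewal α T μ) {t : ℝ} (ht : 0 ≤ t)
    (φ : ℕ → ENNReal) :
    ∀ᵐ ω ∂μ, φ (queueLength Q T t ω) =
      ∑' n, (countEvent T n t).indicator (1 : Ω → ENNReal) ω * φ (Q n ω) := by
  filter_upwards [hT.ae_pos hα, hT.ae_exists_mem_countEvent hα ht] with ω hω ⟨n, hn⟩
  rw [tsum_eq_single n, queueLength, countingProcess_eq hω hn]
  · simp [hn]
  · intro k hk
    have : ω ∉ countEvent T k t := fun h =>
      hk ((countingProcess_eq hω h).symm.trans (countingProcess_eq hω hn))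
    simp [this]

lemma aemeasurable_comp_queueLength (hα : 0 < α) (hT : IsMittagLefflerRenewal α T μ)
    (hQ : ∀ n, Measurable (Q n)) {t : ℝ} (ht : 0 ≤ t) (φ : ℕ → ENNReal) :
    AEMeasurable (fun ω => φ (queueLength Q T t ω)) μ :=
  ⟨_, Measurable.tsum fun n => measurable_indicator_countEvent_mul hT hQ t φ n,
    ae_comp_queueLength_eq hα hT ht φ⟩

/-- The law of the queue length at time `t` is the mixture of the laws of `Q n`, weighted with the
law of the counting process. -/
lemma lintegral_queueLength (hα : 0 < α) (hT : IsMittagLefflerRenewal α T μ)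
    (hQ : ∀ n, Measurable (Q n)) (hQT : IndepFun (fun ω n => Q n ω) (fun ω n => T n ω) μ) {t : ℝ}
    (ht : 0 ≤ t) (φ : ℕ → ENNReal) :
    ∫⁻ ω, φ (queueLength Q T t ω) ∂μ = ∑' n, μ (countEvent T n t) * ∫⁻ ω, φ (Q n ω) ∂μ := by
  have hφ : Measurable φ := measurable_from_top
  have hind : ∀ n, Measurable ((countEvent T n t).indicator (1 : Ω → ENNReal)) := fun n =>
    measurable_one.indicator (hT.measurableSet_countEvent n t)
  rw [lintegral_congr_ae (ae_comp_queueLength_eq hα hT ht φ), lintegral_tsum fun n =>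
    (measurable_indicator_countEvent_mul hT hQ t φ n).aemeasurable]
  refine tsum_congr fun n => ?_
  set B : Set (ℕ → ℝ) :=
    {f | ∑ i ∈ Finset.range n, f i ≤ t ∧ t < ∑ i ∈ Finset.range (n + 1), f i}
  have hB : MeasurableSet B := by
    have hs : ∀ n, Measurable fun f : ℕ → ℝ => ∑ i ∈ Finset.range n, f i := fun n =>
      Finset.measurable_fun_sum _ fun i _ => measurable_pi_apply i
    exact (measurableSet_le (hs n) measurable_const).inter
      (measurableSet_lt measurable_const (hs (n + 1)))
  have hi : IndepFun ((countEvent T n t).indicator (1 : Ω → ENNReal)) (fun ω => φ (Q n ω)) μ :=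
    hQT.symm.comp (φ := B.indicator (1 : (ℕ → ℝ) → ENNReal)) (ψ := fun f : ℕ → ℕ => φ (f n))
      (measurable_one.indicator hB) (hφ.comp (measurable_pi_apply n))
  have := lintegral_mul_eq_lintegral_mul_lintegral_of_indepFun (hind n) (hφ.comp (hQ n)) hi
  simp only [Pi.mul_apply, Function.comp_apply] at this
  rw [this, lintegral_indicator_one (hT.measurableSet_countEvent n t)]

end Counting

/-! ### Moments and one-step recursions of the discrete queue. -/

section Chain

variable {Ω : Type*} [MeasurableSpace Ω] {μ : Measure Ω} {p : ℝ} {Q : ℕ → Ω → ℕ}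

lemma tsum_queueTransition_mul (i : ℕ) (φ : ℕ → ENNReal) :
    ∑' j, ENNReal.ofReal (queueTransition p i j) * φ j =
      ENNReal.ofReal p * φ (i + 1) + ENNReal.ofReal (1 - p) * φ (i - 1) := by
  have hne : i + 1 ≠ i - 1 := by omega
  rw [tsum_eq_sum (s := {i + 1, i - 1}), Finset.sum_pair hne]
  · simp [queueTransition, hne.symm]
  · intro j hj
    simp only [Finset.mem_insert, Finset.mem_singleton, not_or] at hj
    simp [queueTransition, hj]

/-- Integration against the joint law of a random variable with values in `ℕ`. -/
lemma lintegral_comp_nat {X : Ω → ℕ} (hX : Measurable X) (φ : ℕ → ENNReal) :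
    ∫⁻ ω, φ (X ω) ∂μ = ∑' k, μ {ω | X ω = k} * φ k := by
  rw [← lintegral_map (f := φ) measurable_from_top hX, lintegral_countable']
  refine tsum_congr fun k => ?_
  rw [Measure.map_apply hX (measurableSet_singleton k), mul_comm]
  rfl

variable [IsProbabilityMeasure μ]

/-- The Markov property is stated for whole trajectories; summing it over the countably many pasts
of length n leaves the two-step marginal. -/
lemma IsDiscreteQueue.measure_succ (hQ : IsDiscreteQueue p Q μ) (n i j : ℕ) :
    μ {ω | Q n ω = i ∧ Q (n + 1) ω = j} =
      μ {ω | Q n ω = i} * ENNReal.ofReal (queueTransition p i j) := by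
  let X : Ω → Fin n → ℕ := fun ω k => Q k ω
  have hX : Measurable X := measurable_pi_lambda _ fun k => hQ.measurable k
  have hsplit : ∀ A : Set Ω, MeasurableSet A → μ A = ∑' y, μ (X ⁻¹' {y} ∩ A) := fun A hA => by
    rw [← measure_iUnion]
    · rw [← iUnion_inter, ← preimage_iUnion, iUnion_of_singleton, preimage_univ, univ_inter]
    · intro y y' hy
      refine Disjoint.mono inter_subset_left inter_subset_left ?_
      exact Disjoint.preimage _ (by simpa using hy)
    · exact fun y => (hX (measurableSet_singleton y)).inter hA
  have h1 : MeasurableSet {ω | Q n ω = i} := hQ.measurable n (measurableSet_singleton i)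
  have h2 : MeasurableSet {ω | Q (n + 1) ω = j} := hQ.measurable _ (measurableSet_singleton j)
  rw [hsplit {ω | Q n ω = i ∧ Q (n + 1) ω = j} (h1.inter h2), hsplit _ h1, ← ENNReal.tsum_mul_right]
  refine tsum_congr fun y => ?_
  set x : ℕ → ℕ := fun k => if h : k < n then y ⟨k, h⟩ else if k = n then i else j with hx
  have hxn : x n = i := by simp [hx]
  have hxn1 : x (n + 1) = j := by simp [hx]
  have e1 : {ω | ∀ k ≤ n, Q k ω = x k} = X ⁻¹' {y} ∩ {ω | Q n ω = i} := by
    ext ω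
    constructor
    · intro h
      refine ⟨?_, (h n le_rfl).trans hxn⟩
      ext k
      have := h k k.2.le
      simpa [hx, X] using this
    · rintro ⟨h, h'⟩ k hk
      rcases hk.lt_or_eq with hk | rfl
      · have := congrFun (mem_singleton_iff.1 h) ⟨k, hk⟩
        simpa [hx, hk, X] using this
      · exact h'.trans hxn.symm
  have e2 : {ω | ∀ k ≤ n + 1, Q k ω = x k} =
      X ⁻¹' {y} ∩ {ω | Q n ω = i ∧ Q (n + 1) ω = j} := by
    have : {ω | ∀ k ≤ n + 1, Q k ω = x k} =
        {ω | ∀ k ≤ n, Q k ω = x k} ∩ {ω | Q (n + 1) ω = j} := by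
      ext ω
      constructor
      · intro h
        exact ⟨fun k hk => h k (by omega), (h _ le_rfl).trans hxn1⟩
      · rintro ⟨h, h'⟩ k hk
        rcases hk.lt_or_eq with hk | rfl
        · exact h k (by omega)
        · exact h'.trans hxn1.symm
    rw [this, e1, inter_assoc]
    rfl
  have hm := hQ.markov n x
  rw [e1, e2, hxn, hxn1] at hm
  have := congrArg ENNReal.ofReal hm
  rw [ENNReal.ofReal_mul measureReal_nonneg, ofReal_measureReal, ofReal_measureReal] at this
  exact this

/-- One step of the queue, in terms of expectations. -/
lemma IsDiscreteQueue.lintegral_succ (hQ : IsDiscreteQueue p Q μ) (n : ℕ) (φ : ℕ → ENNReal) :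
    ∫⁻ ω, φ (Q (n + 1) ω) ∂μ = ENNReal.ofReal p * ∫⁻ ω, φ (Q n ω + 1) ∂μ +
      ENNReal.ofReal (1 - p) * ∫⁻ ω, φ (Q n ω - 1) ∂μ := by
  have hjoint : ∀ j, μ {ω | Q (n + 1) ω = j} =
      ∑' i, μ {ω | Q n ω = i} * ENNReal.ofReal (queueTransition p i j) := fun j => by
    simp_rw [← hQ.measure_succ]
    rw [← measure_iUnion]
    · congr 1
      ext ω
      simp
    · intro i i' hi
      rw [Function.onFun, Set.disjoint_left]
      rintro ω h h'
      exact hi (h.1.symm.trans h'.1)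
    · exact fun i => (hQ.measurable n (measurableSet_singleton i)).inter
        (hQ.measurable (n + 1) (measurableSet_singleton j))
  rw [lintegral_comp_nat (hQ.measurable (n + 1)),
    lintegral_comp_nat (hQ.measurable n) (fun k => φ (k + 1)),
    lintegral_comp_nat (hQ.measurable n) (fun k => φ (k - 1))]
  simp_rw [hjoint, ← ENNReal.tsum_mul_right]
  rw [ENNReal.tsum_comm, ← ENNReal.tsum_mul_left, ← ENNReal.tsum_mul_left, ← ENNReal.tsum_add]
  refine tsum_congr fun i => ?_
  simp_rw [mul_assoc]
  rw [ENNReal.tsum_mul_left, tsum_queueTransition_mul]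
  ring

lemma IsDiscreteQueue.integral_succ (hp : 0 ≤ p) (hp1 : p ≤ 1) (hQ : IsDiscreteQueue p Q μ)
    (n : ℕ) {φ : ℕ → ℝ} (hφ : ∀ k, 0 ≤ φ k) (h1 : Integrable (fun ω => φ (Q n ω + 1)) μ)
    (h2 : Integrable (fun ω => φ (Q n ω - 1)) μ) :
    ∫ ω, φ (Q (n + 1) ω) ∂μ = p * ∫ ω, φ (Q n ω + 1) ∂μ + (1 - p) * ∫ ω, φ (Q n ω - 1) ∂μ := by
  have hm : Measurable φ := measurable_from_top
  rw [integral_eq_lintegral_of_nonneg_ae (ae_of_all _ fun ω => hφ _)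
    (hm.comp (hQ.measurable _)).aestronglyMeasurable,
    hQ.lintegral_succ n fun k => ENNReal.ofReal (φ k),
    ← ofReal_integral_eq_lintegral_ofReal h1 (ae_of_all _ fun ω => hφ _),
    ← ofReal_integral_eq_lintegral_ofReal h2 (ae_of_all _ fun ω => hφ _),
    ← ENNReal.ofReal_mul hp, ← ENNReal.ofReal_mul (by linarith), ← ENNReal.ofReal_add,
    ENNReal.toReal_ofReal]
  · have := integral_nonneg (μ := μ) (f := fun ω => φ (Q n ω + 1)) fun ω => hφ _
    have := integral_nonneg (μ := μ) (f := fun ω => φ (Q n ω - 1)) fun ω => hφ _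
    have : 0 ≤ 1 - p := by linarith
    positivity
  · exact mul_nonneg hp (integral_nonneg fun ω => hφ _)
  · exact mul_nonneg (by linarith) (integral_nonneg fun ω => hφ _)

/-- Exponential moments of the queue grow at most exponentially. -/
lemma IsDiscreteQueue.lintegral_pow_le (hp : 0 ≤ p) (hp1 : p ≤ 1) (hQ : IsDiscreteQueue p Q μ)
    {y : ℝ} (hy : 0 < y) (n : ℕ) :
    ∫⁻ ω, ENNReal.ofReal (y ^ Q n ω) ∂μ ≤ ENNReal.ofReal (max y y⁻¹ ^ n) := by
  -- Needed in the empty state, where the truncated downward step leaves y^0 = 1 unchanged.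
  have hW1 : 1 ≤ max y y⁻¹ := by
    rcases le_total 1 y with h | h
    · exact le_max_of_le_left h
    · exact le_max_of_le_right ((one_le_inv₀ hy).2 h)
  have hW0 : 0 ≤ max y y⁻¹ := by linarith
  induction n with
  | zero =>
    rw [lintegral_congr_ae (g := fun _ => 1)]
    · simp
    · filter_upwards [hQ.initial] with ω hω
      simp [hω]
  | succ n ih =>
    rw [hQ.lintegral_succ n fun k => ENNReal.ofReal (y ^ k)]
    have hup : ∀ k : ℕ, y ^ (k + 1) ≤ max y y⁻¹ * y ^ k := fun k => by
      rw [pow_succ, mul_comm]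
      gcongr
      exact le_max_left _ _
    have hdown : ∀ k : ℕ, y ^ (k - 1) ≤ max y y⁻¹ * y ^ k := fun k => by
      rcases k with _ | k
      · simpa using hW1
      · calc y ^ k = y⁻¹ * y ^ (k + 1) := by rw [pow_succ]; field_simp
          _ ≤ _ := by gcongr; exact le_max_right _ _
    have hle : ∀ f : ℕ → ℕ, (∀ k, y ^ f k ≤ max y y⁻¹ * y ^ k) →
        ∫⁻ ω, ENNReal.ofReal (y ^ f (Q n ω)) ∂μ ≤ ENNReal.ofReal (max y y⁻¹ ^ (n + 1)) := by
      intro f hf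
      calc ∫⁻ ω, ENNReal.ofReal (y ^ f (Q n ω)) ∂μ
          ≤ ∫⁻ ω, ENNReal.ofReal (max y y⁻¹) * ENNReal.ofReal (y ^ Q n ω) ∂μ := by
            refine lintegral_mono fun ω => ?_
            rw [← ENNReal.ofReal_mul hW0]
            exact ENNReal.ofReal_le_ofReal (hf _)
        _ = ENNReal.ofReal (max y y⁻¹) * ∫⁻ ω, ENNReal.ofReal (y ^ Q n ω) ∂μ :=
            lintegral_const_mul' _ _ ENNReal.ofReal_ne_top
        _ ≤ ENNReal.ofReal (max y y⁻¹) * ENNReal.ofReal (max y y⁻¹ ^ n) := by gcongr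
        _ = _ := by rw [← ENNReal.ofReal_mul hW0, pow_succ']
    calc _ ≤ ENNReal.ofReal p * ENNReal.ofReal (max y y⁻¹ ^ (n + 1)) +
          ENNReal.ofReal (1 - p) * ENNReal.ofReal (max y y⁻¹ ^ (n + 1)) := by
          gcongr
          · exact hle (fun k => k + 1) hup
          · exact hle (fun k => k - 1) hdown
      _ = _ := by
          rw [← add_mul, ← ENNReal.ofReal_add hp (by linarith)]
          simp

lemma IsDiscreteQueue.integrable_pow (hp : 0 ≤ p) (hp1 : p ≤ 1) (hQ : IsDiscreteQueue p Q μ)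
    {y : ℝ} (hy : 0 < y) (n : ℕ) : Integrable (fun ω => y ^ Q n ω) μ := by
  have hm : Measurable fun k : ℕ => y ^ k := measurable_from_top
  refine ⟨(hm.comp (hQ.measurable n)).aestronglyMeasurable, ?_⟩
  rw [hasFiniteIntegral_iff_ofReal (ae_of_all _ fun ω => by positivity)]
  exact (hQ.lintegral_pow_le hp hp1 hy n).trans_lt ENNReal.ofReal_lt_top

lemma IsDiscreteQueue.ofReal_integral_pow (hp : 0 ≤ p) (hp1 : p ≤ 1) (hQ : IsDiscreteQueue p Q μ)
    {y : ℝ} (hy : 0 < y) (n : ℕ) :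
    ENNReal.ofReal (∫ ω, y ^ Q n ω ∂μ) = ∫⁻ ω, ENNReal.ofReal (y ^ Q n ω) ∂μ :=
  ofReal_integral_eq_lintegral_ofReal (hQ.integrable_pow hp hp1 hy n)
    (ae_of_all _ fun ω => by positivity)

lemma IsDiscreteQueue.expBounded_integral_pow (hp : 0 ≤ p) (hp1 : p ≤ 1)
    (hQ : IsDiscreteQueue p Q μ) {y : ℝ} (hy : 0 < y) :
    ExpBounded fun n => ∫ ω, y ^ Q n ω ∂μ := by
  have hW : 0 ≤ max y y⁻¹ := le_max_of_le_left hy.le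
  refine ⟨1, max y y⁻¹, zero_le_one, hW, fun n => ?_⟩
  rw [abs_of_nonneg (integral_nonneg fun ω => by positivity), one_mul,
    ← ENNReal.ofReal_le_ofReal_iff (by positivity), hQ.ofReal_integral_pow hp hp1 hy]
  exact hQ.lintegral_pow_le hp hp1 hy n

/-- The one-step recursion for the exponential moments of the queue. -/
lemma IsDiscreteQueue.integral_pow_succ (hp : 0 ≤ p) (hp1 : p ≤ 1) (hQ : IsDiscreteQueue p Q μ)
    {y : ℝ} (hy : 0 < y) (n : ℕ) :
    ∫ ω, y ^ Q (n + 1) ω ∂μ = (p * y + (1 - p) * y⁻¹) * ∫ ω, y ^ Q n ω ∂μ +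
      (1 - p) * (1 - y⁻¹) * μ.real {ω | Q n ω = 0} := by
  have hint := hQ.integrable_pow hp hp1 hy n
  have hms : MeasurableSet {ω | Q n ω = 0} := hQ.measurable n (measurableSet_singleton 0)
  have hind : Integrable ({ω | Q n ω = 0}.indicator fun _ => (1 : ℝ)) μ :=
    (integrable_const 1).indicator hms
  -- A downward step multiplies by 1/y except in the empty state, where the value stays 1. This
  -- correction is the source of the empty-queue term in the fractional equation.
  have hdown : (fun ω => y ^ (Q n ω - 1)) = fun ω => y⁻¹ * y ^ Q n ω +
      (1 - y⁻¹) * {ω | Q n ω = 0}.indicator (fun _ => (1 : ℝ)) ω := by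
    ext ω
    rcases h : Q n ω with _ | k
    · simp [h]
    · simp [h, pow_succ]
      field_simp
  have hup : (fun ω => y ^ (Q n ω + 1)) = fun ω => y * y ^ Q n ω := by
    ext ω; rw [pow_succ']
  rw [hQ.integral_succ hp hp1 n (φ := fun k => y ^ k) (fun k => by positivity), hup, hdown,
    integral_const_mul, integral_add (hint.const_mul _) (hind.const_mul _), integral_const_mul,
    integral_const_mul, integral_indicator_const _ hms]
  · simp; ring
  · rw [hup]; exact hint.const_mul _
  · rw [hdown]; exact (hint.const_mul _).add (hind.const_mul _)

lemma IsDiscreteQueue.measureReal_succ (hp : 0 ≤ p) (hp1 : p ≤ 1) (hQ : IsDiscreteQueue p Q μ)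
    (n : ℕ) (A : Set ℕ) :
    μ.real {ω | Q (n + 1) ω ∈ A} =
      p * μ.real {ω | Q n ω + 1 ∈ A} + (1 - p) * μ.real {ω | Q n ω - 1 ∈ A} := by
  have hA : ∀ f : ℕ → ℕ, ∀ n, MeasurableSet {ω | f (Q n ω) ∈ A} := fun f n =>
    hQ.measurable n (MeasurableSet.of_discrete (s := f ⁻¹' A))
  have hint : ∀ f : ℕ → ℕ, ∀ n, Integrable (fun ω => A.indicator (fun _ => (1 : ℝ)) (f (Q n ω))) μ :=
    fun f n => (integrable_const (1 : ℝ)).indicator (hA f n)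
  have hval : ∀ f : ℕ → ℕ, ∀ n, ∫ ω, A.indicator (fun _ => (1 : ℝ)) (f (Q n ω)) ∂μ =
      μ.real {ω | f (Q n ω) ∈ A} := fun f n => by
    refine (integral_indicator_const (1 : ℝ) (hA f n)).trans ?_
    simp
  have h := hQ.integral_succ hp hp1 n (φ := A.indicator fun _ => 1)
    (fun k => indicator_nonneg (fun _ _ => zero_le_one) k) (hint (· + 1) n) (hint (· - 1) n)
  rwa [hval (· + 1), hval (· - 1), hval (fun k => k)] at h

lemma IsDiscreteQueue.measureReal_eq_succ_succ (hp : 0 ≤ p) (hp1 : p ≤ 1)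
    (hQ : IsDiscreteQueue p Q μ) (n k : ℕ) :
    μ.real {ω | Q (n + 1) ω = k + 1} =
      p * μ.real {ω | Q n ω = k} + (1 - p) * μ.real {ω | Q n ω = k + 2} := by
  have h := hQ.measureReal_succ hp hp1 n {k + 1}
  simp only [mem_singleton_iff, add_left_inj] at h
  rw [h]
  have : ∀ ω, Q n ω - 1 = k + 1 ↔ Q n ω = k + 2 := fun ω => by omega
  simp only [this]

lemma IsDiscreteQueue.measureReal_eq_zero_succ (hp : 0 ≤ p) (hp1 : p ≤ 1)
    (hQ : IsDiscreteQueue p Q μ) (n : ℕ) :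
    μ.real {ω | Q (n + 1) ω = 0} =
      (1 - p) * (μ.real {ω | Q n ω = 0} + μ.real {ω | Q n ω = 1}) := by
  have h := hQ.measureReal_succ hp hp1 n {0}
  simp only [mem_singleton_iff, Nat.add_eq_zero_iff, one_ne_zero, and_false] at h
  rw [h, ← measureReal_union]
  · have : {ω | Q n ω - 1 = 0} = {ω | Q n ω = 0} ∪ {ω | Q n ω = 1} := by
      ext ω
      simp only [mem_ofPred_eq, mem_union]
      omega
    rw [this]
    simp
  · rw [Set.disjoint_left]
    intro ω h0 h1
    simp only [mem_ofPred_eq] at h0 h1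
    omega
  · exact hQ.measurable n (measurableSet_singleton 1)

lemma IsDiscreteQueue.measureReal_initial (hQ : IsDiscreteQueue p Q μ) (k : ℕ) :
    μ.real {ω | Q 0 ω = k} = if k = 0 then 1 else 0 := by
  have : {ω | Q 0 ω = k} =ᵐ[μ] {_ω : Ω | 0 = k} := by
    filter_upwards [hQ.initial] with ω hω
    refine propext ⟨fun h => ?_, fun h => ?_⟩
    · exact hω.symm.trans h
    · exact hω.trans h
  rw [measureReal_congr this]
  rcases eq_or_ne k 0 with rfl | hk
  · simp
  · simp [hk, hk.symm]

end Chain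

/-! ### Series for the queue length and the fractional equation. -/

section QueueLength

variable {Ω : Type*} [MeasurableSpace Ω] {μ : Measure Ω} [IsProbabilityMeasure μ] {α p : ℝ}
  {T : ℕ → Ω → ℝ} {Q : ℕ → Ω → ℕ}

lemma exp_mul_natCast (z : ℝ) (k : ℕ) : Real.exp (z * k) = Real.exp z ^ k := by
  rw [mul_comm, Real.exp_nat_mul]

lemma hasSum_countEvent_mul (hα : 0 < α) (hT : IsMittagLefflerRenewal α T μ) {b : ℕ → ℝ}
    (hb : ExpBounded b) {t : ℝ} (ht : 0 ≤ t) :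
    HasSum (fun n => μ.real (countEvent T n t) * b n)
      (fracSeries α (fun m => (fwdDiff 1)^[m] b 0) t) := by
  simp_rw [hT.measureReal_countEvent hα _ ht]
  exact hb.hasSum_countCoeff hα ht

lemma lintegral_comp_queueLength_eq_ofReal (hα : 0 < α) (hT : IsMittagLefflerRenewal α T μ)
    (hQ : ∀ n, Measurable (Q n)) (hQT : IndepFun (fun ω n => Q n ω) (fun ω n => T n ω) μ)
    {φ : ℕ → ENNReal} {b : ℕ → ℝ} (hb : ExpBounded b) (hb0 : ∀ n, 0 ≤ b n)
    (hφ : ∀ n, ∫⁻ ω, φ (Q n ω) ∂μ = ENNReal.ofReal (b n)) {t : ℝ} (ht : 0 ≤ t) :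
    ∫⁻ ω, φ (queueLength Q T t ω) ∂μ =
      ENNReal.ofReal (fracSeries α (fun m => (fwdDiff 1)^[m] b 0) t) := by
  have h := hasSum_countEvent_mul hα hT hb ht
  rw [lintegral_queueLength hα hT hQ hQT ht, ← h.tsum_eq,
    ENNReal.ofReal_tsum_of_nonneg (fun n => mul_nonneg measureReal_nonneg (hb0 n)) h.summable]
  refine tsum_congr fun n => ?_
  rw [hφ, ENNReal.ofReal_mul measureReal_nonneg, ofReal_measureReal]

lemma integrable_pow_queueLength (hα : 0 < α) (hp : 0 ≤ p) (hp1 : p ≤ 1)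
    (hT : IsMittagLefflerRenewal α T μ) (hQ : IsDiscreteQueue p Q μ)
    (hQT : IndepFun (fun ω n => Q n ω) (fun ω n => T n ω) μ) {y : ℝ} (hy : 0 < y) {t : ℝ}
    (ht : 0 ≤ t) : Integrable (fun ω => y ^ queueLength Q T t ω) μ := by
  refine ⟨?_, ?_⟩
  · have h := (aemeasurable_comp_queueLength hα hT hQ.measurable ht
      (fun k => ENNReal.ofReal (y ^ k))).ennreal_toReal.aestronglyMeasurable
    refine h.congr (ae_of_all _ fun ω => ?_)
    exact ENNReal.toReal_ofReal (by positivity)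
  · rw [hasFiniteIntegral_iff_ofReal (ae_of_all _ fun ω => by positivity),
      lintegral_comp_queueLength_eq_ofReal hα hT hQ.measurable hQT (φ := fun k => ENNReal.ofReal (y ^ k))
        (hQ.expBounded_integral_pow hp hp1 hy) (fun n => integral_nonneg fun ω => by positivity)
        (fun n => (hQ.ofReal_integral_pow hp hp1 hy n).symm) ht]
    exact ENNReal.ofReal_lt_top

lemma queueMgf_eq_fracSeries (hα : 0 < α) (hp : 0 ≤ p) (hp1 : p ≤ 1)
    (hT : IsMittagLefflerRenewal α T μ) (hQ : IsDiscreteQueue p Q μ)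
    (hQT : IndepFun (fun ω n => Q n ω) (fun ω n => T n ω) μ) (z : ℝ) {t : ℝ} (ht : 0 ≤ t) :
    queueMgf μ Q T z t =
      fracSeries α (fun m => (fwdDiff 1)^[m] (fun n => ∫ ω, Real.exp z ^ Q n ω ∂μ) 0) t := by
  have hy := Real.exp_pos z
  have hb := hQ.expBounded_integral_pow hp hp1 hy
  have hb0 : ∀ n, 0 ≤ ∫ ω, Real.exp z ^ Q n ω ∂μ := fun n => integral_nonneg fun ω => by positivity
  have h := lintegral_comp_queueLength_eq_ofReal hα hT hQ.measurable hQT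
    (φ := fun k => ENNReal.ofReal (Real.exp z ^ k)) hb hb0
    (fun n => (hQ.ofReal_integral_pow hp hp1 hy n).symm) ht
  rw [queueMgf, mgf]
  simp_rw [exp_mul_natCast]
  rw [integral_eq_lintegral_of_nonneg_ae (ae_of_all _ fun ω => by positivity)
    (integrable_pow_queueLength hα hp hp1 hT hQ hQT hy ht).1, h, ENNReal.toReal_ofReal]
  rw [← (hasSum_countEvent_mul hα hT hb ht).tsum_eq]
  exact tsum_nonneg fun n => mul_nonneg measureReal_nonneg (hb0 n)

lemma expBounded_measureReal (Q : ℕ → Ω → ℕ) : ExpBounded fun n => μ.real {ω | Q n ω = 0} :=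
  ⟨1, 1, zero_le_one, zero_le_one, fun n => by
    rw [abs_of_nonneg measureReal_nonneg]
    simp⟩

lemma emptyProb_eq_fracSeries (hα : 0 < α) (hT : IsMittagLefflerRenewal α T μ)
    (hQ : ∀ n, Measurable (Q n)) (hQT : IndepFun (fun ω n => Q n ω) (fun ω n => T n ω) μ) {t : ℝ}
    (ht : 0 ≤ t) :
    emptyProb μ Q T t =
      fracSeries α (fun m => (fwdDiff 1)^[m] (fun n => μ.real {ω | Q n ω = 0}) 0) t := by
  set φ : ℕ → ENNReal := ({0} : Set ℕ).indicator 1 with hφ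
  have hb := expBounded_measureReal (μ := μ) Q
  have h := lintegral_comp_queueLength_eq_ofReal hα hT hQ hQT (φ := φ) hb
    (fun n => measureReal_nonneg) (fun n => ?_) ht
  · have hset : NullMeasurableSet {ω | queueLength Q T t ω = 0} μ := by
      have := (aemeasurable_comp_queueLength hα hT hQ ht φ).nullMeasurable
        (measurableSet_singleton (1 : ENNReal))
      convert this using 1
      ext ω
      by_cases h0 : queueLength Q T t ω = 0 <;> simp [hφ, h0]
    have h2 : ∫⁻ ω, φ (queueLength Q T t ω) ∂μ = μ {ω | queueLength Q T t ω = 0} :=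
      lintegral_indicator_one₀ hset
    rw [emptyProb, Measure.real, ← h2, h, ENNReal.toReal_ofReal]
    rw [← (hasSum_countEvent_mul hα hT hb ht).tsum_eq]
    exact tsum_nonneg fun n => mul_nonneg measureReal_nonneg measureReal_nonneg
  · rw [ofReal_measureReal]
    exact lintegral_indicator_one (hQ n (measurableSet_singleton 0))

/-- The moment generating function of the queue length solves the fractional equation. -/
lemma hasCaputoDerivAt_queueMgf (hα : 0 < α) (hα1 : α ≤ 1) (hp : 0 ≤ p) (hp1 : p ≤ 1)
    (hT : IsMittagLefflerRenewal α T μ) (hQ : IsDiscreteQueue p Q μ)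
    (hQT : IndepFun (fun ω n => Q n ω) (fun ω n => T n ω) μ) (z : ℝ) {t : ℝ} (ht : 0 < t) :
    HasCaputoDerivAt α (queueMgf μ Q T z)
      ((1 - p) * (1 - Real.exp (-z)) * emptyProb μ Q T t +
        (p * Real.exp z - 1 + (1 - p) * Real.exp (-z)) * queueMgf μ Q T z t) t := by
  have hy := Real.exp_pos z
  have hb := hQ.expBounded_integral_pow hp hp1 hy
  set b : ℕ → ℝ := fun n => ∫ ω, Real.exp z ^ Q n ω ∂μ with hbdef
  have h := hb.fwdDiff_iter.hasCaputoDerivAt hα hα1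
    (fun u hu => queueMgf_eq_fracSeries hα hp hp1 hT hQ hQT z hu) ht
  convert h using 1
  -- The Caputo derivative is the average of Δb over the counting process, so the fractional
  -- equation reduces to this identity for each n.
  have hstep : fwdDiff 1 b = fun n => (1 - p) * (1 - Real.exp (-z)) * μ.real {ω | Q n ω = 0} +
      (p * Real.exp z - 1 + (1 - p) * Real.exp (-z)) * b n := by
    ext n
    simp only [fwdDiff, hbdef]
    rw [hQ.integral_pow_succ hp hp1 hy n, Real.exp_neg]
    ring
  have hs1 := hasSum_countEvent_mul hα hT hb ht.le
  have hs2 := hasSum_countEvent_mul hα hT (expBounded_measureReal (μ := μ) Q) ht.le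
  have hs3 := hasSum_countEvent_mul hα hT (b := fwdDiff 1 b) (hb.shift.sub hb) ht.le
  rw [emptyProb_eq_fracSeries hα hT hQ.measurable hQT ht.le,
    queueMgf_eq_fracSeries hα hp hp1 hT hQ hQT z ht.le]
  simp_rw [Function.iterate_succ_apply]
  refine HasSum.unique ((hs2.mul_left _).add (hs1.mul_left _)) ?_
  refine hs3.congr_fun fun n => ?_
  rw [hstep]
  ring

end QueueLength

/-! ### Laplace transforms of the renewal process. -/

section Laplace

variable {Ω : Type*} [MeasurableSpace Ω] {μ : Measure Ω} {α : ℝ} {T : ℕ → Ω → ℝ}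

lemma lintegral_Ici_exp_neg {s : ℝ} (hs : 0 < s) (x : ℝ) :
    ∫⁻ y in Ici x, ENNReal.ofReal (Real.exp (-s * y)) =
      ENNReal.ofReal (Real.exp (-s * x) / s) := by
  rw [setLIntegral_congr Ioi_ae_eq_Ici.symm, ← ofReal_integral_eq_lintegral_ofReal
    (integrableOn_exp_mul_Ioi (by linarith) x) (ae_of_all _ fun y => (Real.exp_pos _).le),
    integral_exp_mul_Ioi (by linarith), neg_div_neg_eq]

variable [IsProbabilityMeasure μ]

lemma integrable_exp_neg_mul {X : Ω → ℝ} (hX : Measurable X) (hpos : ∀ᵐ ω ∂μ, 0 ≤ X ω) {s : ℝ}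
    (hs : 0 ≤ s) : Integrable (fun ω => Real.exp (-s * X ω)) μ := by
  refine (integrable_const (1 : ℝ)).mono' (by fun_prop) ?_
  filter_upwards [hpos] with ω hω
  rw [Real.norm_of_nonneg (Real.exp_pos _).le, Real.exp_le_one_iff]
  nlinarith

/-- The Laplace transform of a distribution function. -/
lemma lintegral_exp_mul_cdf {X : Ω → ℝ} (hX : Measurable X) (hpos : ∀ᵐ ω ∂μ, 0 ≤ X ω) {s : ℝ}
    (hs : 0 < s) :
    ∫⁻ y in Ioi (0 : ℝ), ENNReal.ofReal (Real.exp (-s * y)) * μ {ω | X ω ≤ y} =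
      ENNReal.ofReal (mgf X μ (-s) / s) := by
  rw [← lintegral_setLIntegral_Ici hX hpos (w := fun y => ENNReal.ofReal (Real.exp (-s * y)))
    (by fun_prop)]
  simp_rw [lintegral_Ici_exp_neg hs]
  rw [mgf, ← integral_div, ofReal_integral_eq_lintegral_ofReal
    ((integrable_exp_neg_mul hX hpos hs.le).div_const s)]
  exact ae_of_all _ fun ω => by positivity

lemma integral_exp_mul_fracMonomial (hα : 0 < α) {s : ℝ} (hs : 0 < s) (m : ℕ) :
    ∫ y in Ioi (0 : ℝ), Real.exp (-s * y) * fracMonomial α m y = (s ^ α)⁻¹ ^ m / s := by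
  have ha : 0 < α * m + 1 := by positivity
  have hG := Real.Gamma_pos_of_pos ha
  have h := Real.integral_rpow_mul_exp_neg_mul_Ioi ha hs
  have e : ∀ y : ℝ, Real.exp (-s * y) * fracMonomial α m y =
      (Real.Gamma (α * m + 1))⁻¹ * (y ^ (α * m + 1 - 1) * Real.exp (-(s * y))) := fun y => by
    rw [fracMonomial, add_sub_cancel_right, neg_mul]
    field_simp
  simp_rw [e]
  rw [integral_const_mul, h, one_div, Real.inv_rpow hs.le, Real.rpow_add hs, Real.rpow_mul hs.le,
    Real.rpow_natCast, Real.rpow_one, inv_pow]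
  field_simp

lemma integrableOn_exp_mul_fracMonomial (hα : 0 < α) {s : ℝ} (hs : 0 < s) (m : ℕ) :
    IntegrableOn (fun y => Real.exp (-s * y) * fracMonomial α m y) (Ioi 0) := by
  refine Integrable.of_integral_ne_zero ?_
  rw [integral_exp_mul_fracMonomial hα hs]
  positivity

lemma abs_renewalCoeff_one_le (m : ℕ) : |renewalCoeff 1 m| ≤ 1 := by
  rcases m with _ | m
  · simp [renewalCoeff]
  · simp [renewalCoeff_one_succ]

/-- The Laplace transform of the Mittag-Leffler distribution function, for large arguments. -/
lemma integral_exp_mul_fracSeries (hα : 0 < α) {s : ℝ} (hs : 1 < s) :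
    ∫ y in Ioi (0 : ℝ), Real.exp (-s * y) * fracSeries α (renewalCoeff 1) y =
      (1 + s ^ α)⁻¹ / s := by
  have hs0 : 0 < s := by linarith
  have hsα : 1 < s ^ α := Real.one_lt_rpow hs hα
  set F : ℕ → ℝ → ℝ := fun m y => renewalCoeff 1 m * (Real.exp (-s * y) * fracMonomial α m y) with hF
  have hFint : ∀ m, IntegrableOn (F m) (Ioi 0) := fun m =>
    (integrableOn_exp_mul_fracMonomial hα hs0 m).const_mul _
  -- The transformed terms are geometric of ratio -s^{-α}, so termwise integration needs s > 1.
  have hq : (s ^ α)⁻¹ < 1 := inv_lt_one_of_one_lt₀ hsα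
  have hnorm : ∀ m, ∫ y in Ioi (0 : ℝ), ‖F m y‖ ≤ (s ^ α)⁻¹ ^ m / s := fun m => by
    rw [← integral_exp_mul_fracMonomial hα hs0]
    refine setIntegral_mono_on (hFint m).norm (integrableOn_exp_mul_fracMonomial hα hs0 m)
      measurableSet_Ioi fun y hy => ?_
    have h0 := fracMonomial_nonneg hα (le_of_lt hy) m
    have h1 : 0 ≤ Real.exp (-s * y) * fracMonomial α m y := by positivity
    rw [hF, norm_mul, Real.norm_of_nonneg h1]
    exact mul_le_of_le_one_left h1 (abs_renewalCoeff_one_le m)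
  have hsum : Summable fun m => ∫ y in Ioi (0 : ℝ), ‖F m y‖ :=
    Summable.of_nonneg_of_le (fun m => integral_nonneg fun y => norm_nonneg _) hnorm
      ((summable_geometric_of_lt_one (by positivity) hq).div_const s)
  have h := integral_tsum_of_summable_integral_norm hFint hsum
  have hsummable := (hasSum_integral_of_summable_integral_norm hFint hsum).summable
  simp_rw [hF, integral_const_mul, integral_exp_mul_fracMonomial hα hs0] at h hsummable
  have e : ∀ y, ∑' m, renewalCoeff 1 m * (Real.exp (-s * y) * fracMonomial α m y) =
      Real.exp (-s * y) * fracSeries α (renewalCoeff 1) y := fun y => by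
    rw [fracSeries, ← tsum_mul_left]
    exact tsum_congr fun m => by ring
  simp_rw [e] at h
  rw [← h, hsummable.tsum_eq_zero_add]
  have e2 : ∀ m, renewalCoeff 1 (m + 1) * ((s ^ α)⁻¹ ^ (m + 1) / s) =
      (s ^ α)⁻¹ / s * (-(s ^ α)⁻¹) ^ m := fun m => by
    rw [renewalCoeff_one_succ, neg_pow, pow_succ]
    ring
  simp_rw [e2]
  rw [tsum_mul_left, tsum_geometric_of_abs_lt_one]
  · rw [show renewalCoeff 1 0 = 0 from rfl]
    have h1 : 0 < 1 + s ^ α := by linarith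
    have h2 : 1 - -(s ^ α)⁻¹ = (1 + s ^ α) / s ^ α := by field_simp; ring
    rw [h2]
    field_simp
    ring
  · rwa [abs_neg, abs_of_pos (by positivity)]

lemma IsMittagLefflerRenewal.mgf_eq_of_one_lt (hα : 0 < α) (hT : IsMittagLefflerRenewal α T μ)
    (n : ℕ) {s : ℝ} (hs : 1 < s) : mgf (T n) μ (-s) = (1 + s ^ α)⁻¹ := by
  have hs0 : 0 < s := by linarith
  have hpos : ∀ᵐ ω ∂μ, 0 ≤ T n ω := (hT.ae_pos hα).mono fun ω h => (h n).le
  have h := lintegral_exp_mul_cdf (hT.measurable n) hpos hs0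
  have h2 := integral_exp_mul_fracSeries hα hs
  have hcdf : ∀ y ∈ Ioi (0 : ℝ), Real.exp (-s * y) * fracSeries α (renewalCoeff 1) y =
      Real.exp (-s * y) * μ.real {ω | T n ω ≤ y} := fun y hy => by
    rw [hT.cdf_eq hα n (le_of_lt hy)]
  have hm : Monotone fun y => μ.real {ω | T n ω ≤ y} := fun y y' hy =>
    measureReal_mono fun ω h => le_trans (mem_ofPred.1 h) hy
  rw [setIntegral_congr_fun measurableSet_Ioi hcdf, integral_eq_lintegral_of_nonneg_ae
    (ae_of_all _ fun y => by positivity)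
    (Measurable.aestronglyMeasurable (by have := hm.measurable; fun_prop))] at h2
  have e : ∀ y : ℝ, ENNReal.ofReal (Real.exp (-s * y) * μ.real {ω | T n ω ≤ y}) =
      ENNReal.ofReal (Real.exp (-s * y)) * μ {ω | T n ω ≤ y} := fun y => by
    rw [ENNReal.ofReal_mul (Real.exp_pos _).le, ofReal_measureReal]
  simp_rw [e] at h2
  rw [h, ENNReal.toReal_ofReal (div_nonneg mgf_nonneg hs0.le)] at h2
  exact (div_left_inj' hs0.ne').1 h2

/-- The Laplace transform of the Mittag-Leffler distribution. -/
lemma IsMittagLefflerRenewal.mgf_eq (hα : 0 < α) (hT : IsMittagLefflerRenewal α T μ)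
    (n : ℕ) {s : ℝ} (hs : 0 < s) : mgf (T n) μ (-s) = (1 + s ^ α)⁻¹ := by
  have hpos : ∀ᵐ ω ∂μ, 0 ≤ T n ω := (hT.ae_pos hα).mono fun ω h => (h n).le
  -- Both sides are real-analytic on (0,∞), since a nonnegative variable has an analytic moment
  -- generating function on the negative axis. They agree near s = 2, hence everywhere.
  have hsub : Iio 0 ⊆ interior (integrableExpSet (T n) μ) := by
    refine interior_maximal (fun u hu => ?_) isOpen_Iio
    have := integrable_exp_neg_mul (hT.measurable n) hpos (s := -u) (by linarith [mem_Iio.1 hu])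
    simpa [integrableExpSet] using this
  have hf : AnalyticOnNhd ℝ (fun s => mgf (T n) μ (-s)) (Ioi 0) := fun s hs =>
    (analyticOnNhd_mgf (-s) (hsub (by simpa using hs))).comp_of_eq analyticAt_id.neg rfl
  have hg : AnalyticOnNhd ℝ (fun s : ℝ => (1 + s ^ α)⁻¹) (Ioi 0) := fun s hs => by
    have h1 : AnalyticAt ℝ (fun s : ℝ => s ^ α) s :=
      (Real.contDiffAt_rpow_const_of_ne (n := ⊤) (ne_of_gt hs)).analyticAt
    refine (analyticAt_const.add h1).inv ?_
    have : 0 < s ^ α := Real.rpow_pos_of_pos hs α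
    exact ne_of_gt (show 0 < 1 + s ^ α by linarith)
  refine hf.eqOn_of_preconnected_of_eventuallyEq hg isPreconnected_Ioi
    (show (2 : ℝ) ∈ Ioi 0 by norm_num) ?_ hs
  filter_upwards [lt_mem_nhds (show (1 : ℝ) < 2 by norm_num)] with s hs
  exact hT.mgf_eq_of_one_lt hα n hs

lemma IsMittagLefflerRenewal.mgf_partialSum (hα : 0 < α) (hT : IsMittagLefflerRenewal α T μ)
    (n : ℕ) {s : ℝ} (hs : 0 < s) : mgf (partialSum T n) μ (-s) = (1 + s ^ α)⁻¹ ^ n := by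
  have h := hT.indep.mgf_sum (t := -s) hT.measurable (Finset.range n)
  have e : partialSum T n = ∑ i ∈ Finset.range n, T i := by
    ext ω; simp [partialSum]
  rw [e, h, Finset.prod_congr rfl fun i _ => hT.mgf_eq hα i hs]
  simp

/-- The Laplace transform of the law of the counting process. -/
lemma IsMittagLefflerRenewal.lintegral_exp_mul_countEvent (hα : 0 < α)
    (hT : IsMittagLefflerRenewal α T μ) (n : ℕ) {s : ℝ} (hs : 0 < s) :
    ∫⁻ t in Ioi (0 : ℝ), ENNReal.ofReal (Real.exp (-s * t)) * μ (countEvent T n t) =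
      ENNReal.ofReal (s ^ (α - 1) * (1 + s ^ α)⁻¹ ^ (n + 1)) := by
  have hpos : ∀ n, ∀ᵐ ω ∂μ, 0 ≤ partialSum T n ω := ae_all_iff.1 (hT.partialSum_nonneg hα)
  have h1 := lintegral_exp_mul_cdf (hT.measurable_partialSum n) (hpos n) hs
  have h2 := lintegral_exp_mul_cdf (hT.measurable_partialSum (n + 1)) (hpos (n + 1)) hs
  rw [hT.mgf_partialSum hα _ hs] at h1 h2
  have hsα : 0 < s ^ α := Real.rpow_pos_of_pos hs α
  have hm : Monotone fun t => μ {ω | partialSum T (n + 1) ω ≤ t} := fun y y' hy =>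
    measure_mono fun ω h => le_trans (mem_ofPred.1 h) hy
  have hadd : ∀ t, μ {ω | partialSum T n ω ≤ t} =
      μ (countEvent T n t) + μ {ω | partialSum T (n + 1) ω ≤ t} := fun t => by
    rw [← ofReal_measureReal, ← ofReal_measureReal (s := countEvent T n t),
      ← ofReal_measureReal (s := {ω | partialSum T (n + 1) ω ≤ t}),
      ← ENNReal.ofReal_add measureReal_nonneg measureReal_nonneg,
      hT.measureReal_countEvent_eq_sub hα]
    ring_nf
  simp_rw [hadd, mul_add] at h1
  have hmeas : Measurable fun t => ENNReal.ofReal (Real.exp (-s * t)) *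
      μ {ω | partialSum T (n + 1) ω ≤ t} := Measurable.mul (by fun_prop) hm.measurable
  rw [lintegral_add_right _ hmeas, h2] at h1
  have h3 := ENNReal.eq_sub_of_add_eq ENNReal.ofReal_ne_top h1
  rw [h3, ← ENNReal.ofReal_sub _ (by positivity)]
  congr 1
  -- With x = 1/(1+s^α) one has 1 - x = s^α x, so (x^n - x^{n+1})/s = s^{α-1} x^{n+1}.
  rw [Real.rpow_sub_one hs.ne', pow_succ]
  field_simp
  ring

end Laplace

/-! ### The roots of p r² - (1+s^α) r + (1-p). -/

section Roots

variable {α p s : ℝ}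

lemma discriminant_pos (hs : 0 < s) :
    0 < (1 + s ^ α) ^ 2 - 4 * p * (1 - p) := by
  have hsα : 0 < s ^ α := Real.rpow_pos_of_pos hs α
  nlinarith [sq_nonneg (2 * p - 1)]

lemma r₁_add_r₂ (hp : 0 < p) : p * (r₁ α p s + r₂ α p s) = 1 + s ^ α := by
  unfold r₁ r₂
  field_simp
  ring

lemma r₁_mul_r₂ (hp : 0 < p) (hs : 0 < s) : p * (r₁ α p s * r₂ α p s) = 1 - p := by
  have h := Real.sq_sqrt (discriminant_pos (α := α) (p := p) hs).le
  unfold r₁ r₂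
  set d := Real.sqrt ((1 + s ^ α) ^ 2 - 4 * p * (1 - p))
  field_simp
  ring_nf at h ⊢
  linarith

/-- The difference of the squares is 4p s^α. Equivalently, the quadratic takes the value -s^α < 0 at
1, so 1 lies strictly between the roots. -/
lemma abs_lt_sqrt_discriminant (hp : 0 < p) (hs : 0 < s) :
    |2 * p - (1 + s ^ α)| < Real.sqrt ((1 + s ^ α) ^ 2 - 4 * p * (1 - p)) := by
  have hsα : 0 < s ^ α := Real.rpow_pos_of_pos hs α
  rw [Real.lt_sqrt (abs_nonneg _), sq_abs]
  nlinarith [mul_pos hp hsα]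

lemma one_lt_r₁ (hp : 0 < p) (hs : 0 < s) : 1 < r₁ α p s := by
  have := (abs_lt.1 (abs_lt_sqrt_discriminant (α := α) hp hs)).2
  rw [r₁, lt_div_iff₀ (by positivity)]
  linarith

lemma r₂_lt_one (hp : 0 < p) (hs : 0 < s) : r₂ α p s < 1 := by
  have := (abs_lt.1 (abs_lt_sqrt_discriminant (α := α) hp hs)).1
  rw [r₂, div_lt_iff₀ (by positivity)]
  linarith

lemma r₂_nonneg (hp : 0 < p) (hp1 : p ≤ 1) (hs : 0 < s) : 0 ≤ r₂ α p s := by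
  have h := r₁_mul_r₂ (α := α) hp hs
  have h1 := one_lt_r₁ (α := α) hp hs
  by_contra hneg
  push Not at hneg
  have := mul_neg_of_pos_of_neg (show 0 < p * r₁ α p s by positivity) hneg
  nlinarith

end Roots

/-! ### The discounted occupation measure. -/

/-- A bounded solution of a second-order linear recursion follows the decaying mode. -/
lemma eq_mul_succ_of_bounded {h : ℕ → ℝ} {B ρ σ : ℝ} (hB : ∀ k, |h k| ≤ B) (hσ : 0 ≤ σ)
    (hσ1 : σ < 1) (hrec : ∀ k, h k - ρ * h (k + 1) = σ * (h (k + 1) - ρ * h (k + 2))) (k : ℕ) :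
    h k = ρ * h (k + 1) := by
  -- The defect of the first-order relation at k is σ^j times a bounded quantity for every j, hence
  -- zero.
  have hiter : ∀ j, h k - ρ * h (k + 1) = σ ^ j * (h (k + j) - ρ * h (k + j + 1)) := fun j => by
    induction j with
    | zero => simp
    | succ j ih => rw [ih, hrec (k + j), pow_succ]; ring_nf
  have hbound : ∀ j, |h k - ρ * h (k + 1)| ≤ σ ^ j * (B + |ρ| * B) := fun j => by
    rw [hiter j, abs_mul, abs_of_nonneg (pow_nonneg hσ j)]
    gcongr
    refine (abs_sub _ _).trans (add_le_add (hB _) ?_)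
    rw [abs_mul]
    gcongr
    exact hB _
  have hlim : Tendsto (fun j : ℕ => σ ^ j * (B + |ρ| * B)) atTop (𝓝 0) := by
    simpa using (tendsto_pow_atTop_nhds_zero_of_lt_one hσ hσ1).mul_const (B + |ρ| * B)
  have := abs_nonpos_iff.1 (ge_of_tendsto' hlim hbound)
  linarith

section Chain

variable {Ω : Type*} [MeasurableSpace Ω] {μ : Measure Ω} {p : ℝ} {Q : ℕ → Ω → ℕ}

/-- The discounted occupation measure `∑ xⁿ P(Q_n = k)` of the queue. -/
def occupation (μ : Measure Ω) (Q : ℕ → Ω → ℕ) (x : ℝ) (k : ℕ) : ℝ :=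
  ∑' n, x ^ n * μ.real {ω | Q n ω = k}

lemma occupation_nonneg {x : ℝ} (hx : 0 ≤ x) (k : ℕ) : 0 ≤ occupation μ Q x k :=
  tsum_nonneg fun n => by positivity

variable [IsProbabilityMeasure μ]

lemma summable_occupation {x : ℝ} (hx : 0 ≤ x) (hx1 : x < 1) (k : ℕ) :
    Summable fun n => x ^ n * μ.real {ω | Q n ω = k} :=
  Summable.of_nonneg_of_le (fun n => by positivity)
    (fun n => mul_le_of_le_one_right (by positivity) measureReal_le_one)
    (summable_geometric_of_lt_one hx hx1)

lemma abs_occupation_le {x : ℝ} (hx : 0 ≤ x) (hx1 : x < 1) (k : ℕ) :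
    |occupation μ Q x k| ≤ (1 - x)⁻¹ := by
  rw [abs_of_nonneg (occupation_nonneg hx k), ← tsum_geometric_of_lt_one hx hx1]
  exact (summable_occupation hx hx1 k).tsum_le_tsum
    (fun n => mul_le_of_le_one_right (by positivity) measureReal_le_one)
    (summable_geometric_of_lt_one hx hx1)

lemma IsDiscreteQueue.occupation_succ (hp : 0 ≤ p) (hp1 : p ≤ 1) (hQ : IsDiscreteQueue p Q μ)
    {x : ℝ} (hx : 0 ≤ x) (hx1 : x < 1) (k : ℕ) :
    occupation μ Q x (k + 1) =
      x * (p * occupation μ Q x k + (1 - p) * occupation μ Q x (k + 2)) := by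
  have h1 := (summable_occupation (μ := μ) (Q := Q) hx hx1 k).hasSum.mul_left p
  have h2 := (summable_occupation (μ := μ) (Q := Q) hx hx1 (k + 2)).hasSum.mul_left (1 - p)
  rw [occupation, (summable_occupation hx hx1 (k + 1)).tsum_eq_zero_add, hQ.measureReal_initial]
  simp only [Nat.add_eq_zero_iff, one_ne_zero, and_false, if_false, mul_zero, zero_add]
  refine HasSum.tsum_eq ?_
  refine ((h1.add h2).mul_left x).congr_fun fun n => ?_
  rw [hQ.measureReal_eq_succ_succ hp hp1, pow_succ]
  ring

lemma IsDiscreteQueue.occupation_zero (hp : 0 ≤ p) (hp1 : p ≤ 1) (hQ : IsDiscreteQueue p Q μ)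
    {x : ℝ} (hx : 0 ≤ x) (hx1 : x < 1) :
    occupation μ Q x 0 =
      1 + x * ((1 - p) * (occupation μ Q x 0 + occupation μ Q x 1)) := by
  have h1 := (summable_occupation (μ := μ) (Q := Q) hx hx1 0).hasSum
  have h2 := (summable_occupation (μ := μ) (Q := Q) hx hx1 1).hasSum
  nth_rw 1 [occupation]
  rw [(summable_occupation hx hx1 0).tsum_eq_zero_add, hQ.measureReal_initial]
  simp only [if_true, pow_zero, mul_one]
  congr 1
  refine HasSum.tsum_eq ?_
  refine (((h1.add h2).mul_left (1 - p)).mul_left x).congr_fun fun n => ?_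
  rw [hQ.measureReal_eq_zero_succ hp hp1, pow_succ]
  ring

/-- The discounted occupation measure of the queue is geometric. -/
lemma IsDiscreteQueue.occupation_eq {α s : ℝ} (hp : 0 < p) (hp1 : p ≤ 1)
    (hQ : IsDiscreteQueue p Q μ) (hs : 0 < s) (k : ℕ) :
    occupation μ Q (1 + s ^ α)⁻¹ k =
      (1 + s ^ α) / (p * r₁ α p s * (1 - r₂ α p s)) * (r₁ α p s)⁻¹ ^ k := by
  have hsα : 0 < s ^ α := Real.rpow_pos_of_pos hs α
  have hx : 0 ≤ (1 + s ^ α)⁻¹ := by positivity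
  have hx1 : (1 + s ^ α)⁻¹ < 1 := inv_lt_one_of_one_lt₀ (by linarith)
  have hsum := r₁_add_r₂ (α := α) (s := s) hp
  have hprod := r₁_mul_r₂ (α := α) hp hs
  have hr1 := one_lt_r₁ (α := α) hp hs
  have hr2 := r₂_lt_one (α := α) hp hs
  have hr20 := r₂_nonneg (α := α) hp hp1 hs
  have h0 := hQ.occupation_zero hp.le hp1 hx hx1
  have hsucc := hQ.occupation_succ hp.le hp1 hx hx1
  have hbd := abs_occupation_le (μ := μ) (Q := Q) hx hx1
  set h := occupation μ Q (1 + s ^ α)⁻¹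
  set ρ := r₁ α p s
  set σ := r₂ α p s
  -- By Vieta the recursion is h_k - (ρ+σ) h_{k+1} + ρσ h_{k+2} = 0, written here in factored form.
  have hrec : ∀ k, h k - ρ * h (k + 1) = σ * (h (k + 1) - ρ * h (k + 2)) := fun k => by
    have e := hsucc k
    rw [← hsum, ← hprod, eq_inv_mul_iff_mul_eq₀ (by rw [hsum]; positivity)] at e
    have : p * (h k - ρ * h (k + 1)) = p * (σ * (h (k + 1) - ρ * h (k + 2))) := by
      linear_combination -e
    exact mul_left_cancel₀ hp.ne' this
  have hgeom := eq_mul_succ_of_bounded hbd hr20 hr2 hrec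
  -- Inserting h_0 = ρ h_1 and 1 - p = pρσ in the equation at state 0 leaves pρ(1-σ) h_0 = 1 + s^α.
  have hzero : h 0 = (1 + s ^ α) / (p * ρ * (1 - σ)) := by
    have hσ : 0 < 1 - σ := by linarith
    rw [eq_div_iff (by positivity)]
    have e : h 0 * (1 + s ^ α) = 1 + s ^ α + (1 - p) * (h 0 + h 1) := by
      nth_rw 1 [h0]
      field_simp
    have e1 := hgeom 0
    rw [← hsum, ← hprod] at *
    linear_combination e - p * σ * e1
  induction k with
  | zero => simp [hzero]
  | succ k ih =>
    have e := hgeom k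
    rw [ih] at e
    rw [pow_succ, ← mul_assoc, e]
    field_simp

lemma tsum_ofReal_mul_lintegral_pow (hQ : ∀ n, Measurable (Q n)) {x y : ℝ} (hx : 0 ≤ x)
    (hx1 : x < 1) :
    ∑' n, ENNReal.ofReal (x ^ n) * ∫⁻ ω, ENNReal.ofReal (y ^ Q n ω) ∂μ =
      ∑' k, ENNReal.ofReal (occupation μ Q x k) * ENNReal.ofReal (y ^ k) := by
  simp_rw [fun n => lintegral_comp_nat (μ := μ) (hQ n) fun k => ENNReal.ofReal (y ^ k),
    ← ENNReal.tsum_mul_left]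
  rw [ENNReal.tsum_comm]
  refine tsum_congr fun k => ?_
  rw [occupation, ENNReal.ofReal_tsum_of_nonneg (fun n => by positivity)
    (summable_occupation hx hx1 k), ← ENNReal.tsum_mul_right]
  refine tsum_congr fun n => ?_
  rw [ENNReal.ofReal_mul (by positivity), ofReal_measureReal, mul_assoc]

end Chain

/-! ### The Laplace integral of the moment generating function. -/

section Transform

variable {Ω : Type*} [MeasurableSpace Ω] {μ : Measure Ω} [IsProbabilityMeasure μ] {α p s : ℝ}
  {T : ℕ → Ω → ℝ} {Q : ℕ → Ω → ℕ}

/-- The Laplace integral of the moment generating function as a geometric series. -/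
lemma lintegral_exp_mul_queueMgf (hα : 0 < α) (hp : 0 < p) (hp1 : p ≤ 1)
    (hT : IsMittagLefflerRenewal α T μ) (hQ : IsDiscreteQueue p Q μ)
    (hQT : IndepFun (fun ω n => Q n ω) (fun ω n => T n ω) μ) (z : ℝ) (hs : 0 < s) :
    ∫⁻ t in Ioi (0 : ℝ), ENNReal.ofReal (Real.exp (-s * t) * queueMgf μ Q T z t) =
      ENNReal.ofReal (s ^ (α - 1) / (p * r₁ α p s * (1 - r₂ α p s))) *
        (1 - ENNReal.ofReal (Real.exp z / r₁ α p s))⁻¹ := by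
  have hy := Real.exp_pos z
  have hsα : 0 < s ^ α := Real.rpow_pos_of_pos hs α
  have hx : 0 ≤ (1 + s ^ α)⁻¹ := by positivity
  have hx1 : (1 + s ^ α)⁻¹ < 1 := inv_lt_one_of_one_lt₀ (by linarith)
  have hr1 := one_lt_r₁ (α := α) hp hs
  have hr2 : 0 < 1 - r₂ α p s := sub_pos.2 (r₂_lt_one hp hs)
  have hmgf : ∀ t ∈ Ioi (0 : ℝ), ENNReal.ofReal (Real.exp (-s * t) * queueMgf μ Q T z t) =
      ∑' n, ENNReal.ofReal (Real.exp (-s * t)) * μ (countEvent T n t) *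
        ∫⁻ ω, ENNReal.ofReal (Real.exp z ^ Q n ω) ∂μ := fun t ht => by
    rw [ENNReal.ofReal_mul (Real.exp_pos _).le, queueMgf, mgf]
    simp_rw [exp_mul_natCast, mul_assoc]
    rw [ENNReal.tsum_mul_left, ofReal_integral_eq_lintegral_ofReal
      (integrable_pow_queueLength hα hp.le hp1 hT hQ hQT hy (le_of_lt ht))
      (ae_of_all _ fun ω => by positivity),
      lintegral_queueLength hα hT hQ.measurable hQT (le_of_lt ht)
        fun k => ENNReal.ofReal (Real.exp z ^ k)]
  have hmeas : ∀ n, Measurable fun t => μ (countEvent T n t) := fun n => by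
    have hm : ∀ n, Monotone fun t => μ.real {ω | partialSum T n ω ≤ t} := fun n y y' hy =>
      measureReal_mono fun ω h => le_trans (mem_ofPred.1 h) hy
    have : (fun t => μ (countEvent T n t)) = fun t => ENNReal.ofReal
        (μ.real {ω | partialSum T n ω ≤ t} - μ.real {ω | partialSum T (n + 1) ω ≤ t}) := by
      ext t
      rw [← hT.measureReal_countEvent_eq_sub hα, ofReal_measureReal]
    rw [this]
    exact ((hm n).measurable.sub (hm (n + 1)).measurable).ennreal_ofReal
  have hprod : ∀ n, Measurable fun t =>
      ENNReal.ofReal (Real.exp (-s * t)) * μ (countEvent T n t) := fun n =>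
    Measurable.mul (by fun_prop) (hmeas n)
  rw [setLIntegral_congr_fun measurableSet_Ioi hmgf, lintegral_tsum fun n =>
    ((hprod n).mul_const _).aemeasurable]
  have hterm : ∀ n, ∫⁻ t in Ioi (0 : ℝ), ENNReal.ofReal (Real.exp (-s * t)) * μ (countEvent T n t) *
        ∫⁻ ω, ENNReal.ofReal (Real.exp z ^ Q n ω) ∂μ =
      ENNReal.ofReal (s ^ (α - 1) * (1 + s ^ α)⁻¹) * (ENNReal.ofReal ((1 + s ^ α)⁻¹ ^ n) *
        ∫⁻ ω, ENNReal.ofReal (Real.exp z ^ Q n ω) ∂μ) := fun n => by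
    rw [lintegral_mul_const _ (hprod n), hT.lintegral_exp_mul_countEvent hα n hs,
      ← mul_assoc, ← ENNReal.ofReal_mul (by positivity), pow_succ']
    ring_nf
  simp_rw [hterm]
  -- The sum over time becomes a sum over states, where the occupation measure is geometric. The
  -- geometric series formula in [0,∞] holds for every ratio, so no condition on z enters.
  rw [ENNReal.tsum_mul_left, tsum_ofReal_mul_lintegral_pow hQ.measurable hx hx1,
    ← ENNReal.tsum_geometric, ← ENNReal.tsum_mul_left, ← ENNReal.tsum_mul_left]
  refine tsum_congr fun k => ?_
  rw [hQ.occupation_eq hp hp1 hs, ← ENNReal.ofReal_mul (by positivity),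
    ← ENNReal.ofReal_pow (by positivity), ← ENNReal.ofReal_mul (by positivity),
    ← ENNReal.ofReal_mul (by positivity)]
  congr 1
  rw [div_pow, inv_pow]
  field_simp

lemma aestronglyMeasurable_exp_mul_queueMgf (hα : 0 < α) (hp : 0 ≤ p) (hp1 : p ≤ 1)
    (hT : IsMittagLefflerRenewal α T μ) (hQ : IsDiscreteQueue p Q μ)
    (hQT : IndepFun (fun ω n => Q n ω) (fun ω n => T n ω) μ) (z s : ℝ) :
    AEStronglyMeasurable (fun t => Real.exp (-s * t) * queueMgf μ Q T z t)
      (volume.restrict (Ioi 0)) := by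
  have hb := (hQ.expBounded_integral_pow hp hp1 (Real.exp_pos z)).fwdDiff_iter
  refine ContinuousOn.aestronglyMeasurable ?_ measurableSet_Ioi
  refine ContinuousOn.mul (by fun_prop) fun t ht => ?_
  have hd := (hb.hasDerivAt_fracSeries hα ht).continuousAt
  refine (hd.congr ?_).continuousWithinAt
  filter_upwards [lt_mem_nhds (mem_Ioi.1 ht)] with u hu
  exact (queueMgf_eq_fracSeries hα hp hp1 hT hQ hQT z hu.le).symm

lemma laplaceConvergent_queueMgf_iff (hα : 0 < α) (hp : 0 < p) (hp1 : p ≤ 1)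
    (hT : IsMittagLefflerRenewal α T μ) (hQ : IsDiscreteQueue p Q μ)
    (hQT : IndepFun (fun ω n => Q n ω) (fun ω n => T n ω) μ) (z : ℝ) (hs : 0 < s) :
    LaplaceConvergent (queueMgf μ Q T z) s ↔ Real.exp z < r₁ α p s := by
  have hr1 : 0 < r₁ α p s := one_pos.trans (one_lt_r₁ hp hs)
  have hr2 : 0 < 1 - r₂ α p s := sub_pos.2 (r₂_lt_one hp hs)
  have hc : 0 < s ^ (α - 1) / (p * r₁ α p s * (1 - r₂ α p s)) := by positivity
  have h0 : ∀ t, 0 ≤ Real.exp (-s * t) * queueMgf μ Q T z t := fun t =>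
    mul_nonneg (Real.exp_pos _).le mgf_nonneg
  rw [LaplaceConvergent, IntegrableOn, Integrable,
    and_iff_right (aestronglyMeasurable_exp_mul_queueMgf hα hp.le hp1 hT hQ hQT z s),
    hasFiniteIntegral_iff_ofReal (ae_of_all _ h0), lintegral_exp_mul_queueMgf hα hp hp1 hT hQ hQT z hs,
    ← div_lt_one hr1, ← ENNReal.ofReal_lt_one]
  constructor
  · intro h
    by_contra hge
    rw [not_lt] at hge
    -- For e^z ≥ r₁ the truncated difference is 0 and its inverse ∞; the prefactor is positive, so
    -- the integral diverges.
    rw [tsub_eq_zero_of_le hge, ENNReal.inv_zero, ENNReal.mul_top] at h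
    · exact lt_irrefl _ h
    · simpa using hc
  · intro h
    refine ENNReal.mul_lt_top ENNReal.ofReal_lt_top ?_
    rw [ENNReal.inv_lt_top]
    exact tsub_pos_of_lt h

lemma laplaceTransform_queueMgf (hα : 0 < α) (hp : 0 < p) (hp1 : p ≤ 1)
    (hT : IsMittagLefflerRenewal α T μ) (hQ : IsDiscreteQueue p Q μ)
    (hQT : IndepFun (fun ω n => Q n ω) (fun ω n => T n ω) μ) {z : ℝ} (hs : 0 < s)
    (hz : Real.exp z < r₁ α p s) :
    laplaceTransform (queueMgf μ Q T z) s =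
      -s ^ (α - 1) / (p * (Real.exp z - r₁ α p s) * (1 - r₂ α p s)) := by
  have hr1 : 0 < r₁ α p s := one_pos.trans (one_lt_r₁ hp hs)
  have hr2 : 0 < 1 - r₂ α p s := sub_pos.2 (r₂_lt_one hp hs)
  have hc : 0 < s ^ (α - 1) / (p * r₁ α p s * (1 - r₂ α p s)) := by positivity
  have h0 : ∀ t, 0 ≤ Real.exp (-s * t) * queueMgf μ Q T z t := fun t =>
    mul_nonneg (Real.exp_pos _).le mgf_nonneg
  have hq : 0 < 1 - Real.exp z / r₁ α p s := sub_pos.2 ((div_lt_one hr1).2 hz)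
  rw [laplaceTransform, integral_eq_lintegral_of_nonneg_ae (ae_of_all _ h0)
    (aestronglyMeasurable_exp_mul_queueMgf hα hp.le hp1 hT hQ hQT z s),
    lintegral_exp_mul_queueMgf hα hp hp1 hT hQ hQT z hs, ← ENNReal.ofReal_one,
    ← ENNReal.ofReal_sub _ (by positivity), ENNReal.toReal_mul, ENNReal.toReal_inv,
    ENNReal.toReal_ofReal hc.le, ENNReal.toReal_ofReal hq.le]
  have h1 : Real.exp z - r₁ α p s ≠ 0 := by linarith
  have h2 : r₁ α p s - Real.exp z ≠ 0 := by linarith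
  have e : 1 - Real.exp z / r₁ α p s = (r₁ α p s - Real.exp z) / r₁ α p s := by field_simp
  rw [e, ← neg_sub (r₁ α p s) (Real.exp z)]
  field_simp

end Transform

end FractionalQueue

end

theorem mainTheorem1 {Ω : Type*} [MeasurableSpace Ω] (μ : Measure Ω) [IsProbabilityMeasure μ]
    (α p : ℝ) (hα : 0 < α) (hα1 : α ≤ 1) (hp : 0 < p) (hp1 : p ≤ 1)
    (Q : ℕ → Ω → ℕ) (T : ℕ → Ω → ℝ)
    (hQ : FractionalQueue.IsDiscreteQueue p Q μ)
    (hT : FractionalQueue.IsMittagLefflerRenewal α T μ)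
    (hQT : IndepFun (fun ω n => Q n ω) (fun ω n => T n ω) μ)
    (z : ℝ) :
    (∀ t : ℝ, 0 ≤ t →
      Integrable (fun ω => Real.exp (z * (FractionalQueue.queueLength Q T t ω : ℝ))) μ) ∧
    (∀ t : ℝ, 0 < t →
      FractionalQueue.HasCaputoDerivAt α (FractionalQueue.queueMgf μ Q T z)
        ((1 - p) * (1 - Real.exp (-z)) * FractionalQueue.emptyProb μ Q T t +
          (p * Real.exp z - 1 + (1 - p) * Real.exp (-z)) * FractionalQueue.queueMgf μ Q T z t)
        t) ∧
    (∀ s : ℝ, 0 < s →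
      (FractionalQueue.LaplaceConvergent (FractionalQueue.queueMgf μ Q T z) s ↔
        Real.exp z < FractionalQueue.r₁ α p s) ∧
      (Real.exp z < FractionalQueue.r₁ α p s →
        FractionalQueue.laplaceTransform (FractionalQueue.queueMgf μ Q T z) s =
          -s ^ (α - 1) /
            (p * (Real.exp z - FractionalQueue.r₁ α p s) * (1 - FractionalQueue.r₂ α p s)))) := by
  have hmgf : ∀ t ω, Real.exp (z * (FractionalQueue.queueLength Q T t ω : ℝ)) =
      Real.exp z ^ FractionalQueue.queueLength Q T t ω := fun t ω =>
    FractionalQueue.exp_mul_natCast z _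
  refine ⟨fun t ht => ?_, fun t ht => ?_, fun s hs => ⟨?_, fun hz => ?_⟩⟩
  · simp_rw [hmgf]
    exact FractionalQueue.integrable_pow_queueLength hα hp.le hp1 hT hQ hQT (Real.exp_pos z) ht
  · exact FractionalQueue.hasCaputoDerivAt_queueMgf hα hα1 hp.le hp1 hT hQ hQT z ht
  · exact FractionalQueue.laplaceConvergent_queueMgf_iff hα hp hp1 hT hQ hQT z hs
  · exact FractionalQueue.laplaceTransform_queueMgf hα hp hp1 hT hQ hQT hs hz
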